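/- **Lemma.** Let $G$ be a compact connected simply connected Lie group and let $H\subset K$ be closed connected subgroups, with Lie algebras $\mathfrak h\subset\mathfrak k\subset\mathfrak g$. Let $M=G/H$ carry a $G$-invariant Riemannian metric $ds^2$, let $M'=G/K$ carry a $G$-invariant Riemannian metric, let $\pi:M\to M'$, $\pi(gH)=gK$, be the projection, and let $F=\pi^{-1}(1K)=\{kH : k\in K\}$ be its fiber with the metric induced from $M$. Let $\mathfrak g=\mathfrak k+\mathfrak m'$ and $\mathfrak k=\mathfrak h+\mathfrak m''$ be direct sums with $\mathrm{Ad}(K)\mathfrak m'\subset\mathfrak m'$ and $\mathrm{Ad}(H)\mathfrak m''\subset\mathfrak m''$, so that $\mathfrak m'$, $\mathfrak m''$ and $\mathfrak m'+\mathfrak m''$ represent the tangent spaces of $M'$, $F$ and $M$ at the base points. Assume that * $M'$ and $F$ are Riemannian symmetric spaces as coset spaces of $G$ and of $K$, with tangent spaces $\mathfrak m'$ and $\mathfrak m''$; and * $\mathfrak m'\perp\mathfrak m''$ in the tangent space of $(M,ds^2)$ at $1H$. Here a coset space $A/B$ with an $A$-invariant metric and tangent space $\mathfrak m$, where $\mathfrak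 a=\mathfrak b+\mathfrak m$, is called Riemannian symmetric as a coset space of $A$ if $\mathfrak m=\mathfrak p+\mathfrak l$ is an orthogonal sum of subspaces with $[\mathfrak p,\mathfrak l]=0$ such that $\mathfrak p$ is $\mathrm{Ad}(B)$-invariant with $[\mathfrak p,\mathfrak p]\subset\mathfrak b$ (a symmetric coset space) and $\mathfrak l$ is $\mathrm{Ad}(A)$-invariant with $\mathrm{Ad}(A)$-invariant inner product (a Lie group with bi-invariant metric); either summand may be $0$. Then: 1. $F$ is totally geodesic in $M$: every geodesic of $F$ is a geodesic of $M$, and every geodesic of $M$ that is tangent to $F$ at some point lies in $F$. 2. $F$ is a geodesic orbit space: every geodesic of $F$ has the form $t\mapsto\exp(t\xi)x$ with $x\in F$ and $\xi\in\mathfrak k$. 3. Every geodesic of $M$ that is tangent to $F$ at some point has the form $t\mapsto\exp(t\xi)x$ with $x\in F$ and $\xi\in\mathfrak m''_x$. Here $\mathfrak m''_x$ is the representative at $x$ of the tangent space of $F$: $\mathfrak m''_x=\mathrm{Ad}(k)\mathfrak m''$ for $x=kH$, $k\in K$. (So $\xi\in\mathfrak m''$ if $x=1H$, or if $\mathfrak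 m''$ is $\mathrm{Ad}(K)$-invariant.) Geodesics are parametrized on open intervals, and constant ones are allowed. -/

import Mathlib

open scoped Manifold ContDiff Topology
open Set

noncomputable section

namespace GeodesicOrbit

/-! ### Riemannian geometry in charts -/

section Riemannian

variable {E : Type*} [NormedAddCommGroup E] [NormedSpace ℝ E]
  {M : Type*} [TopologicalSpace M] [ChartedSpace E M] [IsManifold 𝓘(ℝ, E) ∞ M]

/-- A smooth Riemannian metric on `M`. -/
abbrev RiemannianMetric (E : Type*) [NormedAddCommGroup E] [NormedSpace ℝ E]
    (M : Type*) [TopologicalSpace M] [ChartedSpace E M] [IsManifold 𝓘(ℝ, E) ∞ M] :=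
  Bundle.ContMDiffRiemannianMetric 𝓘(ℝ, E) ∞ E (fun x : M => TangentSpace 𝓘(ℝ, E) x)

/-- The coefficients `g_y(v, w)` of the metric in the chart around `a`, as a function of the
chart coordinate `y`. -/
def chartMetric (g : RiemannianMetric E M) (a : M) (y v w : E) : ℝ :=
  g.inner ((extChartAt 𝓘(ℝ, E) a).symm y)
    (mfderiv 𝓘(ℝ, E) 𝓘(ℝ, E) (extChartAt 𝓘(ℝ, E) a).symm y v)
    (mfderiv 𝓘(ℝ, E) 𝓘(ℝ, E) (extChartAt 𝓘(ℝ, E) a).symm y w)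

/-- The velocity vector of a curve. -/
def velocity (c : ℝ → M) (t : ℝ) : TangentSpace 𝓘(ℝ, E) (c t) :=
  mfderiv 𝓘(ℝ, ℝ) 𝓘(ℝ, E) c t (1 : ℝ)

/-- The pairing `⟨∇_{c'} c', w⟩` of the covariant acceleration of `c` (for the Levi-Civita
connection) with `w`, in the chart around `a`: with `u` the coordinate expression of `c`,
`g_u(u'', w) + Γ_u(u', u'; w)`, where the Christoffel symbols of the first kind, on equal
arguments, are `Γ_y(v, v; w) = D_v g_y(v, w) - ½ D_w g_y(v, v)`. -/
def covariantAcceleration (g : RiemannianMetric E M) (c : ℝ → M) (a : M) (t : ℝ) (w : E) : ℝ :=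
  let u : ℝ → E := fun s => extChartAt 𝓘(ℝ, E) a (c s)
  chartMetric g a (u t) (deriv (deriv u) t) w
    + fderiv ℝ (fun y => chartMetric g a y (deriv u t) w) (u t) (deriv u t)
    - 1 / 2 * fderiv ℝ (fun y => chartMetric g a y (deriv u t) (deriv u t)) (u t) w

/-- `c` is a geodesic of `(M, g)` on the open interval `J`: it satisfies the geodesic equation
`∇_{c'} c' = 0` in every chart. Constant curves are allowed. -/
def IsGeodesicOn (g : RiemannianMetric E M) (c : ℝ → M) (J : Set ℝ) : Prop :=
  ContMDiffOn 𝓘(ℝ, ℝ) 𝓘(ℝ, E) 2 c J ∧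
    ∀ t ∈ J, ∀ a : M, c t ∈ (extChartAt 𝓘(ℝ, E) a).source →
      ∀ w : E, covariantAcceleration g c a t w = 0

/-- `c` is, on the open interval `J`, a geodesic of the submanifold `F` of `M` with tangent
spaces `T x` and the induced metric: a curve in `F` whose covariant acceleration in `M` is
orthogonal to `F`. (By the Gauss formula the component of `∇_{c'} c'` tangent to `F` is the
covariant acceleration in `F`.) -/
def IsSubmanifoldGeodesicOn (g : RiemannianMetric E M) (F : Set M)
    (T : ∀ x : M, Set (TangentSpace 𝓘(ℝ, E) x)) (c : ℝ → M) (J : Set ℝ) : Prop :=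
  ContMDiffOn 𝓘(ℝ, ℝ) 𝓘(ℝ, E) 2 c J ∧
    (∀ t ∈ J, c t ∈ F ∧ velocity c t ∈ T (c t)) ∧
    ∀ t ∈ J, ∀ a : M, c t ∈ (extChartAt 𝓘(ℝ, E) a).source →
      ∀ v ∈ T (c t), covariantAcceleration g c a t
        (mfderiv 𝓘(ℝ, E) 𝓘(ℝ, E) (extChartAt 𝓘(ℝ, E) a) (c t) v) = 0

/-- `c` is tangent to the submanifold `F` (with tangent spaces `T x`) at the time `t`. -/
def IsTangentAt (F : Set M) (T : ∀ x : M, Set (TangentSpace 𝓘(ℝ, E) x))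
    (c : ℝ → M) (t : ℝ) : Prop :=
  c t ∈ F ∧ velocity c t ∈ T (c t)

/-- The submanifold `F` is totally geodesic in `(M, g)`, in both of the usual senses: the
geodesics of `F` are geodesics of `M`, and a geodesic of `M` that is tangent to `F` at some point
stays in `F`. -/
def IsTotallyGeodesic (g : RiemannianMetric E M) (F : Set M)
    (T : ∀ x : M, Set (TangentSpace 𝓘(ℝ, E) x)) : Prop :=
  (∀ (J : Set ℝ) (c : ℝ → M), IsOpen J → J.OrdConnected →
      IsSubmanifoldGeodesicOn g F T c J → IsGeodesicOn g c J) ∧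
    ∀ (J : Set ℝ) (c : ℝ → M), IsOpen J → J.OrdConnected → IsGeodesicOn g c J →
      (∃ t ∈ J, IsTangentAt F T c t) → ∀ t ∈ J, c t ∈ F

end Riemannian

/-! ### Lie groups -/

section LieGroup

variable {E : Type*} [NormedAddCommGroup E] [NormedSpace ℝ E]
  {G : Type*} [TopologicalSpace G] [ChartedSpace E G] [Group G]

/-- `γ` is the one-parameter subgroup `t ↦ exp (t ξ)` of `G`: a homomorphism `ℝ → G` with
velocity `ξ` at `0`. -/
def IsExpCurve (γ : ℝ → G) (ξ : GroupLieAlgebra 𝓘(ℝ, E) G) : Prop :=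
  γ 0 = 1 ∧ (∀ s t, γ (s + t) = γ s * γ t) ∧
    HasMFDerivAt 𝓘(ℝ, ℝ) 𝓘(ℝ, E) γ 0
      (ContinuousLinearMap.toSpanSingleton ℝ (ξ : E) : ℝ →L[ℝ] E)

/-- The Lie algebra `{ξ : exp (t ξ) ∈ K for all t}` of a closed subgroup `K` of `G`. -/
def lieAlg (K : Subgroup G) : Set (GroupLieAlgebra 𝓘(ℝ, E) G) :=
  {ξ | ∃ γ : ℝ → G, IsExpCurve γ ξ ∧ ∀ t, γ t ∈ K}

/-- The adjoint representation: `Ad a` is the differential at `1` of `x ↦ a x a⁻¹`. -/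
def Ad (a : G) (ξ : GroupLieAlgebra 𝓘(ℝ, E) G) : GroupLieAlgebra 𝓘(ℝ, E) G :=
  (mfderiv 𝓘(ℝ, E) 𝓘(ℝ, E) (fun x : G => a * x * a⁻¹) 1 ξ : E)

/-- For closed subgroups `B ≤ A` of `G` with Lie algebras `𝔟 ⊆ 𝔞`: `𝔪` is an `Ad(B)`-invariant
complement of `𝔟` in `𝔞`, so that `𝔪` represents the tangent space of `A/B` at `1B`. -/
structure IsReductiveComplement (A B : Subgroup G)
    (𝔪 : Submodule ℝ (GroupLieAlgebra 𝓘(ℝ, E) G)) : Prop where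
  subset : ∀ X ∈ 𝔪, X ∈ lieAlg A
  disjoint : ∀ X ∈ 𝔪, X ∈ lieAlg B → X = 0
  decomp : ∀ X ∈ lieAlg (E := E) A, ∃ Y ∈ lieAlg (E := E) B, ∃ Z ∈ 𝔪, X = Y + Z
  invariant : ∀ b ∈ B, ∀ X ∈ 𝔪, Ad b X ∈ 𝔪

/-- The coset space `A/B`, with tangent space `𝔪` at `1B` and with the `A`-invariant Riemannian
metric given by the `Ad(B)`-invariant inner product `q` on `𝔪`, is a Riemannian symmetric space
as a coset space of `A`: infinitesimally it is the Riemannian product of a symmetric coset space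
(tangent space `𝔭` with `[𝔭, 𝔭] ⊆ 𝔟`) and of a Lie group with a bi-invariant metric (an ideal `𝔩`
of `𝔞` on which `q` is `Ad(A)`-invariant); either factor may be trivial. -/
structure IsRiemannianSymmetric (A B : Subgroup G)
    (𝔪 : Submodule ℝ (GroupLieAlgebra 𝓘(ℝ, E) G))
    (q : LinearMap.BilinForm ℝ (GroupLieAlgebra 𝓘(ℝ, E) G)) : Prop where
  reductive : IsReductiveComplement A B 𝔪
  symm : ∀ X ∈ 𝔪, ∀ Y ∈ 𝔪, q X Y = q Y X
  pos : ∀ X ∈ 𝔪, X ≠ 0 → 0 < q X X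
  invariant : ∀ b ∈ B, ∀ X ∈ 𝔪, ∀ Y ∈ 𝔪, q (Ad b X) (Ad b Y) = q X Y
  symmetric : ∃ 𝔭 𝔩 : Submodule ℝ (GroupLieAlgebra 𝓘(ℝ, E) G),
    𝔭 ⊔ 𝔩 = 𝔪 ∧
    (∀ X ∈ 𝔭, ∀ Y ∈ 𝔩, q X Y = 0) ∧
    (∀ X ∈ 𝔭, ∀ Y ∈ 𝔩, ⁅X, Y⁆ = 0) ∧
    (∀ b ∈ B, ∀ X ∈ 𝔭, Ad b X ∈ 𝔭) ∧
    (∀ X ∈ 𝔭, ∀ Y ∈ 𝔭, ⁅X, Y⁆ ∈ lieAlg (E := E) B) ∧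
    (∀ a ∈ A, ∀ X ∈ 𝔩, Ad a X ∈ 𝔩) ∧
    (∀ a ∈ A, ∀ X ∈ 𝔩, ∀ Y ∈ 𝔩, q (Ad a X) (Ad a Y) = q X Y)

end LieGroup

/-! ### The homogeneous space `M = G/H` and the fiber of `G/H → G/K` -/

section Homogeneous

variable {E E' : Type*} [NormedAddCommGroup E] [NormedSpace ℝ E]
  [NormedAddCommGroup E'] [NormedSpace ℝ E']
  {G : Type*} [TopologicalSpace G] [ChartedSpace E G] [Group G]
  {H : Subgroup G} [ChartedSpace E' (G ⧸ H)]

/-- The given manifold structure on `G/H` is the usual one: `G` acts smoothly on it and the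
projection `G → G/H` is a submersion. -/
structure IsHomogeneousManifold (E E' : Type*) [NormedAddCommGroup E] [NormedSpace ℝ E]
    [NormedAddCommGroup E'] [NormedSpace ℝ E']
    {G : Type*} [TopologicalSpace G] [ChartedSpace E G] [Group G]
    (H : Subgroup G) [ChartedSpace E' (G ⧸ H)] : Prop where
  smooth_smul : ContMDiffSMul 𝓘(ℝ, E) 𝓘(ℝ, E') ∞ G (G ⧸ H)
  smooth_mk : ContMDiff 𝓘(ℝ, E) 𝓘(ℝ, E') ∞ (QuotientGroup.mk : G → G ⧸ H)
  submersion : ∀ a : G, Function.Surjective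
    (mfderiv 𝓘(ℝ, E) 𝓘(ℝ, E') (QuotientGroup.mk : G → G ⧸ H) a)

/-- The metric on `G/H` is `G`-invariant. -/
def IsInvariantMetric [IsManifold 𝓘(ℝ, E') ∞ (G ⧸ H)]
    (g : RiemannianMetric E' (G ⧸ H)) : Prop :=
  ∀ (a : G) (x : G ⧸ H) (v w : TangentSpace 𝓘(ℝ, E') x),
    g.inner (a • x)
      (mfderiv 𝓘(ℝ, E') 𝓘(ℝ, E') (fun y : G ⧸ H => a • y) x v)
      (mfderiv 𝓘(ℝ, E') 𝓘(ℝ, E') (fun y : G ⧸ H => a • y) x w) = g.inner x v w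

/-- The metric at the base point `1H`, pulled back to the Lie algebra of `G` along the
differential of `G → G/H`. On a complement of the Lie algebra of `H` it is the inner product
given by the metric of `G/H`. -/
def basePointForm [IsManifold 𝓘(ℝ, E') ∞ (G ⧸ H)]
    (g : RiemannianMetric E' (G ⧸ H)) :
    LinearMap.BilinForm ℝ (GroupLieAlgebra 𝓘(ℝ, E) G) :=
  LinearMap.mk₂ ℝ
    (fun X Y => g.inner ((1 : G) : G ⧸ H)
      (mfderiv 𝓘(ℝ, E) 𝓘(ℝ, E') (QuotientGroup.mk : G → G ⧸ H) 1 X)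
      (mfderiv 𝓘(ℝ, E) 𝓘(ℝ, E') (QuotientGroup.mk : G → G ⧸ H) 1 Y))
    (by intros; simp only [map_add, add_apply])
    (by intros; simp only [map_smul, smul_apply])
    (by intros; simp only [map_add])
    (by intros; simp only [map_smul])

/-- The fiber `F` over `1K` of the projection `G/H → G/K`, `gH ↦ gK`. -/
def fiber {K : Subgroup G} (hHK : H ≤ K) : Set (G ⧸ H) :=
  Subgroup.quotientMapOfLE hHK ⁻¹' {((1 : G) : G ⧸ K)}

/-- The tangent space at `x` of the orbit `K x`: the values at `x` of the vector fields on `G/H`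
generated by the Lie algebra of `K`. (The fiber over `1K` is the `K`-orbit of `1H`.) -/
def orbitTangent (E : Type*) {E' : Type*} [NormedAddCommGroup E] [NormedSpace ℝ E]
    [NormedAddCommGroup E'] [NormedSpace ℝ E']
    {G : Type*} [TopologicalSpace G] [ChartedSpace E G] [Group G]
    (H K : Subgroup G) [ChartedSpace E' (G ⧸ H)] (x : G ⧸ H) :
    Set (TangentSpace 𝓘(ℝ, E') x) :=
  {v | ∃ X ∈ lieAlg (E := E) K,
    v = (mfderiv 𝓘(ℝ, E) 𝓘(ℝ, E') (fun a : G => a • x) 1 X : E')}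

/-- The representative at the point `x = kH` of `F` (`k ∈ K`) of the tangent space of `F`: if `𝔪''`
represents it at `1H`, then at `kH` it is represented by `Ad(k) 𝔪''`. -/
def complementAt {E : Type*} [NormedAddCommGroup E] [NormedSpace ℝ E]
    {G : Type*} [TopologicalSpace G] [ChartedSpace E G] [Group G]
    (H K : Subgroup G) (𝔪 : Submodule ℝ (GroupLieAlgebra 𝓘(ℝ, E) G)) (x : G ⧸ H) :
    Set (GroupLieAlgebra 𝓘(ℝ, E) G) :=
  {ξ | ∃ k ∈ K, x = (k : G ⧸ H) ∧ ∃ ζ ∈ 𝔪, ξ = Ad k ζ}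

end Homogeneous

end GeodesicOrbit

end

open GeodesicOrbit

/-!
The proof works with momenta. For `Z` in the Lie algebra of `G`, let `Z*` be the fundamental field
of `Z` on `M = G/H`, and call `⟨c', Z*⟩` the momentum of the curve `c` for `Z`. Since `Z*` is a
Killing field, the derivative of this momentum is the pairing of the covariant acceleration of `c`
with `Z*` (`hasDerivAt_momentum`). As the fields `Z*` span every tangent space, a curve of class
`C²` is a geodesic exactly when all its momenta are constant. Moreover a curve is determined by its
momenta and one of its points (`eqOn_of_momentum_eq`): they prescribe its velocity as a function of
its position, so that the uniqueness theorem for first order differential equations applies.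

*Geodesics of `M` tangent to `F`.* Write `Q` for the metric at `1H`, pulled back to the Lie
algebra of `G`. A tangent vector of `F` at `kH` is the value there of the fundamental field of
`Ad(k) ζ` for some `ζ` in `𝔪''`. The curve `t ↦ k exp(tζ) H` has this velocity at `t = 0`, and its
momentum for `Z` at the time `t` is `Q(ζ, Ad(exp(-tζ)) Ad(k⁻¹) Z)`. This does not depend on `t`
(`IsExpCurve.basePointForm_Ad_eq`). Indeed, for a `Z` in `𝔪'` it vanishes, since `𝔪'` is
`Ad(K)`-invariant and orthogonal to `𝔪''`. For a `W` in `𝔨` the derivative of `Q(ζ, Ad(exp(tζ)) W)`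
is a value `Q(ζ, [ζ, W'])` with `W'` in `𝔨`, and it vanishes because `F` is symmetric
(`IsRiemannianSymmetric.basePointForm_bracket_eq_zero`). So the geodesic with the same initial
velocity has the same momenta, and it is this curve (`IsGeodesicOn.exists_eq_mk_mul`).

*Geodesics of `F`.* A geodesic of `F` has constant momenta for `𝔨`, by the definition of a geodesic
of `F`. Its momenta for `𝔪'` vanish, because `𝔪'` is `Ad(K)`-invariant and orthogonal to `𝔪''`. The
two together give constant momenta for all of `𝔤 = 𝔨 + 𝔪'`, so it is a geodesic of `M`
(`IsSubmanifoldGeodesicOn.isGeodesicOn`), tangent to `F` at each of its points.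

Tangent spaces are handled as copies of the model space: `AdL`, `chartD`, `orbitD`, `smulD`,
`metricAt` and `vel` restate the differentials, the metric and the velocity as maps between normed
spaces, where the calculus of `fderiv` applies.
-/

noncomputable section

namespace GeodesicOrbit

/-! ### Adjoint action and one-parameter subgroups -/

section Basic

variable {E : Type*} [NormedAddCommGroup E] [NormedSpace ℝ E]
  {F : Type*} [NormedAddCommGroup F] [NormedSpace ℝ F]
  {M : Type*} [TopologicalSpace M] [ChartedSpace E M]
  {N : Type*} [TopologicalSpace N] [ChartedSpace F N]

theorem hasMFDerivAt_of_eq {f : M → N} {x y : M} {f' : E →L[ℝ] F}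
    (h : HasMFDerivAt 𝓘(ℝ, E) 𝓘(ℝ, F) f x f') (e : x = y) :
    HasMFDerivAt 𝓘(ℝ, E) 𝓘(ℝ, F) f y f' := by
  subst e; exact h

/-- The chain rule with the midpoint given up to a propositional equality, all derivatives being
maps between the model spaces. -/
theorem hasMFDerivAt_comp_of_eq {V P : Type*} [NormedAddCommGroup V] [NormedSpace ℝ V]
    [TopologicalSpace P] [ChartedSpace V P] {g : N → P} {f : M → N} {x : M} {y : N}
    {g' : F →L[ℝ] V} {f' : E →L[ℝ] F} (hg : HasMFDerivAt 𝓘(ℝ, F) 𝓘(ℝ, V) g y g')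
    (hf : HasMFDerivAt 𝓘(ℝ, E) 𝓘(ℝ, F) f x f') (e : f x = y) :
    HasMFDerivAt 𝓘(ℝ, E) 𝓘(ℝ, V) (fun z => g (f z)) x (g'.comp f') := by
  subst e; exact HasMFDerivAt.comp x hg hf

theorem hasFDerivAt_of_hasMFDerivAt {f : E → F} {x : E} {f' : E →L[ℝ] F}
    (h : HasMFDerivAt 𝓘(ℝ, E) 𝓘(ℝ, F) f x f') : HasFDerivAt f f' x :=
  hasMFDerivAt_iff_hasFDerivAt.1 h

theorem hasDerivAt_of_hasMFDerivAt {f : ℝ → F} {t : ℝ} {v : F}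
    (h : HasMFDerivAt 𝓘(ℝ, ℝ) 𝓘(ℝ, F) f t (ContinuousLinearMap.toSpanSingleton ℝ v)) :
    HasDerivAt f v t := by
  exact (hasFDerivAt_of_hasMFDerivAt h).hasDerivAt.congr_deriv
    (ContinuousLinearMap.toSpanSingleton_apply_one ℝ v)

theorem comp_toSpanSingleton_comp_id (T : E →L[ℝ] F) (v : E) :
    T.comp ((ContinuousLinearMap.toSpanSingleton ℝ v).comp (ContinuousLinearMap.id ℝ ℝ)) =
      (1 : ℝ →L[ℝ] ℝ).smulRight (T v) := by
  ext; simp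

theorem comp_smulRight_one (T : E →L[ℝ] F) (v : E) :
    T.comp ((1 : ℝ →L[ℝ] ℝ).smulRight v) = (1 : ℝ →L[ℝ] ℝ).smulRight (T v) := by
  ext; simp

end Basic

section LieGroup

variable {E : Type*} [NormedAddCommGroup E] [NormedSpace ℝ E]
  {G : Type*} [TopologicalSpace G] [ChartedSpace E G] [Group G]

/-- `Ad a` as a continuous linear map of the model space of `G`. -/
def AdL (a : G) : E →L[ℝ] E :=
  mfderiv 𝓘(ℝ, E) 𝓘(ℝ, E) (fun x : G => a * x * a⁻¹) 1

theorem Ad_add (a : G) (ξ η : GroupLieAlgebra 𝓘(ℝ, E) G) : Ad a (ξ + η) = Ad a ξ + Ad a η :=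
  (AdL a : E →L[ℝ] E).map_add ξ η

theorem IsExpCurve.neg_apply {γ : ℝ → G} {ξ : GroupLieAlgebra 𝓘(ℝ, E) G} (h : IsExpCurve γ ξ)
    (t : ℝ) : γ (-t) = (γ t)⁻¹ := by
  rw [eq_inv_iff_mul_eq_one, ← h.2.1, neg_add_cancel, h.1]

variable [LieGroup 𝓘(ℝ, E) ∞ G]

theorem contMDiff_conj (a : G) :
    ContMDiff 𝓘(ℝ, E) 𝓘(ℝ, E) ∞ (fun x : G => a * x * a⁻¹) :=
  (contMDiff_const.mul contMDiff_id).mul contMDiff_const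

theorem hasMFDerivAt_conj (a : G) :
    HasMFDerivAt 𝓘(ℝ, E) 𝓘(ℝ, E) (fun x : G => a * x * a⁻¹) 1 (AdL a : E →L[ℝ] E) :=
  ((contMDiff_conj a).mdifferentiableAt (by simp)).hasMFDerivAt

theorem AdL_mul (a b : G) : (AdL (a * b) : E →L[ℝ] E) = (AdL a).comp (AdL b) := by
  have h1 := hasMFDerivAt_of_eq (hasMFDerivAt_conj (E := E) a) (show 1 = b * 1 * b⁻¹ by simp)
  have h2 := HasMFDerivAt.comp (1 : G) h1 (hasMFDerivAt_conj (E := E) b)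
  have h3 : ((fun x : G => a * x * a⁻¹) ∘ fun x => b * x * b⁻¹) =
      fun x => (a * b) * x * (a * b)⁻¹ := by
    ext x; simp [mul_assoc]
  rw [h3] at h2
  exact (hasMFDerivAt_unique (hasMFDerivAt_conj (E := E) (a * b)) h2)

theorem AdL_one : (AdL (1 : G) : E →L[ℝ] E) = ContinuousLinearMap.id ℝ E := by
  have h := hasMFDerivAt_conj (E := E) (1 : G)
  have h3 : (fun x : G => (1 : G) * x * (1 : G)⁻¹) = id := by ext x; simp
  rw [h3] at h
  exact hasMFDerivAt_unique h (hasMFDerivAt_id (1 : G))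

theorem Ad_mul (a b : G) (ξ : GroupLieAlgebra 𝓘(ℝ, E) G) : Ad (a * b) ξ = Ad a (Ad b ξ) :=
  congrArg (fun T : E →L[ℝ] E => T ξ) (AdL_mul a b)

theorem Ad_one (ξ : GroupLieAlgebra 𝓘(ℝ, E) G) : Ad (1 : G) ξ = ξ :=
  congrArg (fun T : E →L[ℝ] E => T ξ) AdL_one

theorem Ad_inv_Ad (a : G) (ξ : GroupLieAlgebra 𝓘(ℝ, E) G) : Ad a⁻¹ (Ad a ξ) = ξ := by
  rw [← Ad_mul, inv_mul_cancel, Ad_one]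

theorem Ad_Ad_inv (a : G) (ξ : GroupLieAlgebra 𝓘(ℝ, E) G) : Ad a (Ad a⁻¹ ξ) = ξ := by
  rw [← Ad_mul, mul_inv_cancel, Ad_one]

theorem IsExpCurve.conj {γ : ℝ → G} {ξ : GroupLieAlgebra 𝓘(ℝ, E) G} (h : IsExpCurve γ ξ) (a : G) :
    IsExpCurve (fun t => a * γ t * a⁻¹) (Ad a ξ) := by
  refine ⟨by simp [h.1], fun s t => by simp [h.2.1, mul_assoc], ?_⟩
  have h1 := hasMFDerivAt_of_eq (hasMFDerivAt_conj (E := E) a) h.1.symm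
  have h2 := HasMFDerivAt.comp (0 : ℝ) h1 h.2.2
  exact h2.congr_mfderiv (ContinuousLinearMap.comp_toSpanSingleton (AdL a : E →L[ℝ] E) ξ)

/-- A one-parameter subgroup is an integral curve of the left-invariant field of its velocity. -/
theorem IsExpCurve.isMIntegralCurve {γ : ℝ → G} {ξ : GroupLieAlgebra 𝓘(ℝ, E) G}
    (h : IsExpCurve γ ξ) :
    IsMIntegralCurve γ (mulInvariantVectorField (I := 𝓘(ℝ, E)) ξ) := by
  intro t
  have h0 : HasMFDerivAt 𝓘(ℝ, ℝ) 𝓘(ℝ, ℝ) (fun s : ℝ => s - t) t (ContinuousLinearMap.id ℝ ℝ) :=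
    ((hasFDerivAt_id t).sub_const t).hasMFDerivAt
  have h1 := HasMFDerivAt.comp (f := fun s : ℝ => s - t) t
    (hasMFDerivAt_of_eq h.2.2 (sub_self t).symm) h0
  have h2 : HasMFDerivAt 𝓘(ℝ, E) 𝓘(ℝ, E) (fun x : G => γ t * x) 1
      (mfderiv 𝓘(ℝ, E) 𝓘(ℝ, E) (fun x : G => γ t * x) 1 : E →L[ℝ] E) :=
    ((contMDiff_mul_left (I := 𝓘(ℝ, E)) (n := ∞)).mdifferentiableAt (by simp)).hasMFDerivAt
  have h3 := HasMFDerivAt.comp t (hasMFDerivAt_of_eq h2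
    (show 1 = (γ ∘ fun s => s - t) t by simp [h.1])) h1
  have h4 : ((fun x : G => γ t * x) ∘ γ ∘ fun s => s - t) = γ := by
    ext s
    simp [← h.2.1]
  rw [h4] at h3
  exact h3.congr_mfderiv (comp_toSpanSingleton_comp_id (E := E) (F := E)
    (mfderiv 𝓘(ℝ, E) 𝓘(ℝ, E) (fun x : G => γ t * x) 1) ξ)

theorem lieGroup_minSmoothness : LieGroup 𝓘(ℝ, E) (minSmoothness ℝ 3) G :=
  LieGroup.of_le (n := ∞) (by
    rw [minSmoothness_of_isRCLikeNormedField]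
    exact WithTop.coe_le_coe.2 (le_top : (3 : ℕ∞) ≤ ⊤))

theorem contMDiff_one_mulInvariantVectorField (ξ : GroupLieAlgebra 𝓘(ℝ, E) G) :
    haveI : IsManifold 𝓘(ℝ, E) 1 G := IsManifold.of_le (n := ∞) (by simp)
    ContMDiff 𝓘(ℝ, E) 𝓘(ℝ, E).tangent 1 (fun g : G =>
      (⟨g, mulInvariantVectorField ξ g⟩ : TangentBundle 𝓘(ℝ, E) G)) := by
  have := lieGroup_minSmoothness (E := E) (G := G)
  exact (contMDiff_mulInvariantVectorField (I := 𝓘(ℝ, E)) ξ).of_le (by simp)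

theorem IsMIntegralCurveOn.mul_left {γ : ℝ → G} {ξ : GroupLieAlgebra 𝓘(ℝ, E) G} {s : Set ℝ}
    (h : IsMIntegralCurveOn γ (mulInvariantVectorField (I := 𝓘(ℝ, E)) ξ) s) (a : G) :
    IsMIntegralCurveOn (fun t => a * γ t) (mulInvariantVectorField (I := 𝓘(ℝ, E)) ξ) s := by
  intro t ht
  have hm (b c : G) : HasMFDerivAt 𝓘(ℝ, E) 𝓘(ℝ, E) (fun x : G => b * x) c
      (mfderiv 𝓘(ℝ, E) 𝓘(ℝ, E) (fun x : G => b * x) c : E →L[ℝ] E) :=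
    ((contMDiff_mul_left (I := 𝓘(ℝ, E)) (n := ∞)).mdifferentiableAt (by simp)).hasMFDerivAt
  have h1 := HasMFDerivAt.comp_hasMFDerivWithinAt t (hm a (γ t)) (h t ht)
  have h2 := HasMFDerivAt.comp (1 : G) (hasMFDerivAt_of_eq (hm a (γ t)) (mul_one (γ t)).symm)
    (hm (γ t) 1)
  have h3 : (fun x : G => a * x) ∘ (fun x => γ t * x) = fun x => a * γ t * x := by
    ext x; simp [mul_assoc]
  rw [h3] at h2
  have h4 : (mfderiv 𝓘(ℝ, E) 𝓘(ℝ, E) (fun x : G => a * x) (γ t) : E →L[ℝ] E)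
      (mulInvariantVectorField (I := 𝓘(ℝ, E)) ξ (γ t)) =
      mulInvariantVectorField (I := 𝓘(ℝ, E)) ξ (a * γ t) :=
    congrArg (fun T : E →L[ℝ] E => T ξ) (hasMFDerivAt_unique h2 (hm (a * γ t) 1))
  refine h1.congr_mfderiv ?_
  exact (comp_smulRight_one (E := E) (F := E) (mfderiv 𝓘(ℝ, E) 𝓘(ℝ, E) (fun x : G => a * x) (γ t))
    (mulInvariantVectorField (I := 𝓘(ℝ, E)) ξ (γ t))).trans
    (congrArg (fun v : E => (1 : ℝ →L[ℝ] ℝ).smulRight v) h4)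

variable [T2Space G]

theorem IsExpCurve.unique {γ γ' : ℝ → G} {ξ : GroupLieAlgebra 𝓘(ℝ, E) G}
    (h : IsExpCurve γ ξ) (h' : IsExpCurve γ' ξ) : γ = γ' := by
  have : IsManifold 𝓘(ℝ, E) 1 G := IsManifold.of_le (n := ∞) (by simp)
  exact isMIntegralCurve_Ioo_eq_of_contMDiff_boundaryless (t₀ := 0)
    (contMDiff_one_mulInvariantVectorField ξ) h.isMIntegralCurve h'.isMIntegralCurve
    (h.1.trans h'.1.symm)

/-- The exponential map is defined everywhere: left translates of a local integral curve of a
left-invariant field extend it by a uniform time, so it extends to all of `ℝ`. -/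
theorem exists_isExpCurve [CompleteSpace E] (ξ : GroupLieAlgebra 𝓘(ℝ, E) G) :
    ∃ γ : ℝ → G, IsExpCurve γ ξ := by
  have : IsManifold 𝓘(ℝ, E) 1 G := IsManifold.of_le (n := ∞) (by simp)
  have hv := contMDiff_one_mulInvariantVectorField (E := E) (G := G) ξ
  obtain ⟨γ₀, h0, h1⟩ := exists_isMIntegralCurveAt_of_contMDiffAt_boundaryless 0
    (hv.contMDiffAt (x := 1))
  obtain ⟨ε, hε, h2⟩ := isMIntegralCurveAt_iff'.1 h1
  rw [Real.ball_eq_Ioo, zero_sub, zero_add] at h2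
  obtain ⟨γ, h3, h4⟩ := exists_isMIntegralCurve_of_isMIntegralCurveOn hv hε
    (fun x => ⟨fun t => x * γ₀ t, by simp [h0], IsMIntegralCurveOn.mul_left h2 x⟩) 1
  refine ⟨γ, h3, fun s t => ?_, ?_⟩
  · have h5 := h4.comp_add s
    have h6 := isMIntegralCurve_iff_isMIntegralCurveOn.2
      (IsMIntegralCurveOn.mul_left (isMIntegralCurve_iff_isMIntegralCurveOn.1 h4) (γ s))
    have h7 := isMIntegralCurve_Ioo_eq_of_contMDiff_boundaryless (t₀ := 0) hv h5 h6
      (by simp [h3])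
    have := congrFun h7 t
    simpa [add_comm] using this
  · refine (h4 0).congr_mfderiv ?_
    have h8 : (mulInvariantVectorField (I := 𝓘(ℝ, E)) ξ (γ 0) : E) = ξ := by
      rw [h3]
      have h9 : (fun x : G => (1 : G) * x) = id := by ext x; simp
      exact (congrArg (fun T : E →L[ℝ] E => T ξ) (h9 ▸ mfderiv_id (I := 𝓘(ℝ, E)) (x := (1 : G)) :
        (mfderiv 𝓘(ℝ, E) 𝓘(ℝ, E) (fun x : G => (1 : G) * x) 1 : E →L[ℝ] E) =
          ContinuousLinearMap.id ℝ E))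
    refine Eq.trans ?_ (ContinuousLinearMap.smulRight_one_eq_toSpanSingleton (R₁ := ℝ) (ξ : E))
    exact congrArg (fun v : E => (1 : ℝ →L[ℝ] ℝ).smulRight v) h8

end LieGroup

/-! ### Derivatives of maps of two variables, and of charts -/

section Calculus

variable {E F V : Type*} [NormedAddCommGroup E] [NormedSpace ℝ E]
  [NormedAddCommGroup F] [NormedSpace ℝ F] [NormedAddCommGroup V] [NormedSpace ℝ V]

theorem hasFDerivAt_fderiv_prodMk_left {f : E × F → V} {x : E} {y : F}
    (hf : ContDiffAt ℝ 2 f (x, y)) :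
    HasFDerivAt (fun x' => fderiv ℝ f (x', y))
      ((fderiv ℝ (fderiv ℝ f) (x, y)).comp (ContinuousLinearMap.inl ℝ E F)) x :=
  (((hf.fderiv_right (m := 1) (by norm_num)).differentiableAt (by simp)).hasFDerivAt).comp x
    (hasFDerivAt_prodMk_left x y)

theorem hasFDerivAt_fderiv_prodMk_right {f : E × F → V} {x : E} {y : F}
    (hf : ContDiffAt ℝ 2 f (x, y)) :
    HasFDerivAt (fun y' => fderiv ℝ f (x, y'))
      ((fderiv ℝ (fderiv ℝ f) (x, y)).comp (ContinuousLinearMap.inr ℝ E F)) y :=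
  (((hf.fderiv_right (m := 1) (by norm_num)).differentiableAt (by simp)).hasFDerivAt).comp y
    (hasFDerivAt_prodMk_right x y)

theorem fderiv_apply_prodMk_left {f : E × F → V} {x : E} {y : F}
    (hf : DifferentiableAt ℝ f (x, y)) (v : E) :
    fderiv ℝ f (x, y) (v, 0) = fderiv ℝ (fun x' => f (x', y)) x v := by
  have := (HasFDerivAt.comp (g := f) (f := fun x' => (x', y)) x hf.hasFDerivAt
    (hasFDerivAt_prodMk_left x y)).fderiv
  exact (congrArg (fun T : E →L[ℝ] V => T v) this).symm

theorem fderiv_apply_prodMk_right {f : E × F → V} {x : E} {y : F}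
    (hf : DifferentiableAt ℝ f (x, y)) (v : F) :
    fderiv ℝ f (x, y) (0, v) = fderiv ℝ (fun y' => f (x, y')) y v := by
  have := (HasFDerivAt.comp (g := f) y hf.hasFDerivAt (hasFDerivAt_prodMk_right x y)).fderiv
  exact (congrArg (fun T : F →L[ℝ] V => T v) this).symm

/-- The derivative of the adjoint action in terms of the second derivative of the multiplication:
`F` is a local multiplication with unit `e`, and `C (x, y) = x y x⁻¹`. -/
theorem hasFDerivAt_local_adjoint {F C : E × E → E} {e : E} (hF : ContDiffAt ℝ 2 F (e, e))
    (hC : ContDiffAt ℝ 2 C (e, e)) (hFr : ∀ᶠ x in 𝓝 e, F (x, e) = x)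
    (hFl : ∀ᶠ x in 𝓝 e, F (e, x) = x) (hCe : ∀ᶠ x in 𝓝 e, C (x, e) = e)
    (hFC : ∀ᶠ p in 𝓝 (e, e), F (C p, p.1) = F p) (η : E) :
    ∃ D : E →L[ℝ] E, HasFDerivAt (fun x => fderiv ℝ C (x, e) (0, η)) D e ∧
      ∀ ξ, D ξ = fderiv ℝ (fun x => fderiv ℝ F (x, e) (0, η)) e ξ
        - fderiv ℝ (fun x => fderiv ℝ F (x, e) (0, ξ)) e η := by
  have hFd : DifferentiableAt ℝ F (e, e) := hF.differentiableAt (by simp)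
  have hunitl (v : E) : fderiv ℝ F (e, e) (v, 0) = v := by
    rw [fderiv_apply_prodMk_left hFd, Filter.EventuallyEq.fderiv_eq (f := id) hFr, fderiv_id]
    rfl
  have hunitr (v : E) : fderiv ℝ F (e, e) (0, v) = v := by
    rw [fderiv_apply_prodMk_right hFd, Filter.EventuallyEq.fderiv_eq (f := id) hFl, fderiv_id]
    rfl
  -- Differentiate `F (C (x, y), x) = F (x, y)` with respect to `y` at `y = e`.
  have hnear : ∀ᶠ x in 𝓝 e, fderiv ℝ F (e, x) (fderiv ℝ C (x, e) (0, η), 0)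
      = fderiv ℝ F (x, e) (0, η) := by
    have t1 : Filter.Tendsto (fun x : E => (x, e)) (𝓝 e) (𝓝 (e, e)) :=
      (continuous_id.prodMk continuous_const).tendsto e
    have t2 : Filter.Tendsto (fun x : E => (e, x)) (𝓝 e) (𝓝 (e, e)) :=
      (continuous_const.prodMk continuous_id).tendsto e
    have d1 := t2.eventually (hF.eventually (by simp))
    have d2 := t1.eventually (hC.eventually (by simp))
    filter_upwards [d1, d2, hCe, t1.eventually hFC.eventually_nhds] with x h1 h2 h3 h4
    have h1' : DifferentiableAt ℝ F (C (x, e), x) := by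
      rw [h3]; exact h1.differentiableAt (by simp)
    have h5 := HasFDerivAt.comp (x, e) (f := fun p : E × E => (C p, p.1)) h1'.hasFDerivAt
      ((h2.differentiableAt (by simp)).hasFDerivAt.prodMk hasFDerivAt_fst)
    have h6 := (Filter.EventuallyEq.fderiv_eq h4).symm.trans h5.fderiv
    rw [h6, h3]
    simp
  have hC1 : fderiv ℝ C (e, e) (0, η) = η := by
    have := hnear.self_of_nhds
    rwa [hunitl, hunitr] at this
  have hD := (hasFDerivAt_fderiv_prodMk_left hC).clm_apply (hasFDerivAt_const ((0 : E), η) e)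
  refine ⟨_, hD, fun ξ => ?_⟩
  -- Then differentiate the outcome with respect to `x` at `x = e`.
  have hb (v : E) := (hasFDerivAt_fderiv_prodMk_left hF).clm_apply
    (hasFDerivAt_const ((0 : E), v) e)
  have hP := (hasFDerivAt_fderiv_prodMk_right hF).clm_apply
    (hD.prodMk (hasFDerivAt_const (0 : E) e))
  have hsymm : IsSymmSndFDerivAt ℝ F (e, e) := hF.isSymmSndFDerivAt (by simp)
  have h1 := congrArg (fun T : E →L[ℝ] E => T ξ)
    ((hP.congr_of_eventuallyEq (Filter.EventuallyEq.symm hnear)).unique (hb η))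
  rw [(hb η).fderiv, (hb ξ).fderiv]
  simp [hC1, hunitl] at h1 ⊢
  rw [← h1, hsymm.eq (0, ξ) (η, 0)]
  abel

end Calculus

section Chart

variable {E : Type*} [NormedAddCommGroup E] [NormedSpace ℝ E]
  {M : Type*} [TopologicalSpace M] [ChartedSpace E M]

/-- The differential at `x` of the chart around `a`. -/
def chartD (a x : M) : E →L[ℝ] E := mfderiv 𝓘(ℝ, E) 𝓘(ℝ, E) (extChartAt 𝓘(ℝ, E) a) x

/-- The differential at `y` of the inverse of the chart around `a`. -/
def chartDSymm (a : M) (y : E) : E →L[ℝ] E :=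
  mfderiv 𝓘(ℝ, E) 𝓘(ℝ, E) (extChartAt 𝓘(ℝ, E) a).symm y

variable [IsManifold 𝓘(ℝ, E) 1 M]

theorem hasMFDerivAt_extChartAt {a x : M} (hx : x ∈ (extChartAt 𝓘(ℝ, E) a).source) :
    HasMFDerivAt 𝓘(ℝ, E) 𝓘(ℝ, E) (extChartAt 𝓘(ℝ, E) a) x (chartD (E := E) a x) :=
  (mdifferentiableAt_extChartAt (by rwa [extChartAt_source] at hx)).hasMFDerivAt

theorem hasMFDerivAt_extChartAt_symm {a : M} {y : E} (hy : y ∈ (extChartAt 𝓘(ℝ, E) a).target) :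
    HasMFDerivAt 𝓘(ℝ, E) 𝓘(ℝ, E) (extChartAt 𝓘(ℝ, E) a).symm y (chartDSymm (E := E) a y) := by
  have := mdifferentiableWithinAt_extChartAt_symm hy
  simp only [modelWithCornersSelf_coe, range_id, mdifferentiableWithinAt_univ] at this
  exact this.hasMFDerivAt

theorem chartD_comp_chartDSymm {a : M} {y : E} (hy : y ∈ (extChartAt 𝓘(ℝ, E) a).target) :
    (chartD (E := E) a ((extChartAt 𝓘(ℝ, E) a).symm y)).comp (chartDSymm a y) =
      ContinuousLinearMap.id ℝ E := by
  have := mfderiv_extChartAt_comp_mfderivWithin_extChartAt_symm hy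
  simp only [modelWithCornersSelf_coe, range_id, mfderivWithin_univ] at this
  exact this

theorem chartDSymm_comp_chartD {a x : M} (hx : x ∈ (extChartAt 𝓘(ℝ, E) a).source) :
    (chartDSymm a (extChartAt 𝓘(ℝ, E) a x)).comp (chartD (E := E) a x) =
      ContinuousLinearMap.id ℝ E := by
  have := mfderivWithin_extChartAt_symm_comp_mfderiv_extChartAt' hx
  simp only [modelWithCornersSelf_coe, range_id, mfderivWithin_univ] at this
  exact this

theorem chartD_self (a : M) : chartD (E := E) a a = ContinuousLinearMap.id ℝ E := by
  have h := mfderiv_chartAt_eq_tangentCoordChange (I := 𝓘(ℝ, E)) (mem_chart_source E a)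
  have h2 : chartD (E := E) a a = tangentCoordChange 𝓘(ℝ, E) a a a := by
    rw [← h]; simp [chartD, mfld_simps]; rfl
  rw [h2]
  ext v
  exact tangentCoordChange_self (mem_extChartAt_source a)

theorem chartDSymm_self (a : M) :
    chartDSymm (E := E) a (extChartAt 𝓘(ℝ, E) a a) = ContinuousLinearMap.id ℝ E := by
  have := chartDSymm_comp_chartD (E := E) (mem_extChartAt_source (I := 𝓘(ℝ, E)) a)
  rwa [chartD_self, ContinuousLinearMap.comp_id] at this

end Chart

/-! ### The derivative of the adjoint action along a one-parameter subgroup -/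

section Read

variable {E F V : Type*} [NormedAddCommGroup E] [NormedSpace ℝ E]
  [NormedAddCommGroup F] [NormedSpace ℝ F] [NormedAddCommGroup V] [NormedSpace ℝ V]
  {M N P : Type*} [TopologicalSpace M] [ChartedSpace E M] [IsManifold 𝓘(ℝ, E) ∞ M]
  [TopologicalSpace N] [ChartedSpace F N] [IsManifold 𝓘(ℝ, F) ∞ N]
  [TopologicalSpace P] [ChartedSpace V P] [IsManifold 𝓘(ℝ, V) ∞ P]

theorem contDiffAt_read_in_charts {f : M × N → P}
    (hf : ContMDiff (𝓘(ℝ, E).prod 𝓘(ℝ, F)) 𝓘(ℝ, V) ∞ f) (a : M) (b : N) (c : P) {x : E} {y : F}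
    (hx : x ∈ (extChartAt 𝓘(ℝ, E) a).target) (hy : y ∈ (extChartAt 𝓘(ℝ, F) b).target)
    (hc : f ((extChartAt 𝓘(ℝ, E) a).symm x, (extChartAt 𝓘(ℝ, F) b).symm y) ∈
      (extChartAt 𝓘(ℝ, V) c).source) :
    ContDiffAt ℝ ∞ (fun p : E × F => extChartAt 𝓘(ℝ, V) c
      (f ((extChartAt 𝓘(ℝ, E) a).symm p.1, (extChartAt 𝓘(ℝ, F) b).symm p.2))) (x, y) := by
  rw [← contMDiffAt_iff_contDiffAt]
  have h1 : ContMDiffAt 𝓘(ℝ, E) 𝓘(ℝ, E) ∞ (extChartAt 𝓘(ℝ, E) a).symm x :=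
    (contMDiffOn_extChartAt_symm a).contMDiffAt ((isOpen_extChartAt_target a).mem_nhds hx)
  have h2 : ContMDiffAt 𝓘(ℝ, F) 𝓘(ℝ, F) ∞ (extChartAt 𝓘(ℝ, F) b).symm y :=
    (contMDiffOn_extChartAt_symm b).contMDiffAt ((isOpen_extChartAt_target b).mem_nhds hy)
  have h3 : ContMDiffAt 𝓘(ℝ, E × F) 𝓘(ℝ, E) ∞
      (fun p : E × F => (extChartAt 𝓘(ℝ, E) a).symm p.1) (x, y) :=
    ContMDiffAt.comp (x, y) (g := (extChartAt 𝓘(ℝ, E) a).symm) (f := Prod.fst) h1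
      contDiffAt_fst.contMDiffAt
  have h4 : ContMDiffAt 𝓘(ℝ, E × F) 𝓘(ℝ, F) ∞
      (fun p : E × F => (extChartAt 𝓘(ℝ, F) b).symm p.2) (x, y) :=
    ContMDiffAt.comp (x, y) (g := (extChartAt 𝓘(ℝ, F) b).symm) (f := Prod.snd) h2
      contDiffAt_snd.contMDiffAt
  have h5 : ContMDiffAt 𝓘(ℝ, V) 𝓘(ℝ, V) ∞ (extChartAt 𝓘(ℝ, V) c)
      (f ((extChartAt 𝓘(ℝ, E) a).symm x, (extChartAt 𝓘(ℝ, F) b).symm y)) :=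
    contMDiffAt_extChartAt' (by rwa [extChartAt_source] at hc)
  exact ContMDiffAt.comp (x, y) h5 (ContMDiffAt.comp (x, y) hf.contMDiffAt (h3.prodMk h4))

end Read

section LieGroup

variable {E : Type*} [NormedAddCommGroup E] [NormedSpace ℝ E]
  {G : Type*} [TopologicalSpace G] [ChartedSpace E G] [Group G]

/-- The multiplication of `G` in the chart around `1`. -/
def mulChart (E : Type*) [NormedAddCommGroup E] [NormedSpace ℝ E]
    (G : Type*) [TopologicalSpace G] [ChartedSpace E G] [Group G] (p : E × E) : E :=
  extChartAt 𝓘(ℝ, E) (1 : G)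
    ((extChartAt 𝓘(ℝ, E) (1 : G)).symm p.1 * (extChartAt 𝓘(ℝ, E) (1 : G)).symm p.2)

/-- The conjugation `(x, y) ↦ x y x⁻¹` of `G` in the chart around `1`. -/
def conjChart (E : Type*) [NormedAddCommGroup E] [NormedSpace ℝ E]
    (G : Type*) [TopologicalSpace G] [ChartedSpace E G] [Group G] (p : E × E) : E :=
  extChartAt 𝓘(ℝ, E) (1 : G)
    ((extChartAt 𝓘(ℝ, E) (1 : G)).symm p.1 * (extChartAt 𝓘(ℝ, E) (1 : G)).symm p.2 *
      ((extChartAt 𝓘(ℝ, E) (1 : G)).symm p.1)⁻¹)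

variable [LieGroup 𝓘(ℝ, E) ∞ G]

theorem isManifold_one {M : Type*} [TopologicalSpace M] [ChartedSpace E M]
    [IsManifold 𝓘(ℝ, E) ∞ M] : IsManifold 𝓘(ℝ, E) 1 M :=
  IsManifold.of_le (n := ∞) (by simp)

theorem contDiffAt_mulChart {x : E} (hx : x ∈ (extChartAt 𝓘(ℝ, E) (1 : G)).target) :
    ContDiffAt ℝ ∞ (mulChart E G) (x, extChartAt 𝓘(ℝ, E) (1 : G) 1) := by
  refine contDiffAt_read_in_charts (f := fun p : G × G => p.1 * p.2) (contMDiff_mul 𝓘(ℝ, E) ∞)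
    1 1 1 hx (mem_extChartAt_target 1) ?_
  simpa using (extChartAt 𝓘(ℝ, E) (1 : G)).map_target hx

theorem contDiffAt_conjChart {x : E} (hx : x ∈ (extChartAt 𝓘(ℝ, E) (1 : G)).target) :
    ContDiffAt ℝ ∞ (conjChart E G) (x, extChartAt 𝓘(ℝ, E) (1 : G) 1) := by
  refine contDiffAt_read_in_charts (f := fun p : G × G => p.1 * p.2 * p.1⁻¹)
    ((contMDiff_fst.mul contMDiff_snd).mul contMDiff_fst.inv)
    1 1 1 hx (mem_extChartAt_target 1) ?_
  simp

/-- A left-invariant field, read in the chart around `1`, is a partial derivative of the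
multiplication. -/
theorem chartD_mulInvariantVectorField {x : E} (hx : x ∈ (extChartAt 𝓘(ℝ, E) (1 : G)).target)
    (ξ : E) :
    chartD (E := E) (1 : G) ((extChartAt 𝓘(ℝ, E) (1 : G)).symm x)
      (mulInvariantVectorField (I := 𝓘(ℝ, E)) (G := G) ξ ((extChartAt 𝓘(ℝ, E) (1 : G)).symm x)) =
    fderiv ℝ (mulChart E G) (x, extChartAt 𝓘(ℝ, E) (1 : G) 1) (0, ξ) := by
  have : IsManifold 𝓘(ℝ, E) 1 G := isManifold_one
  rw [fderiv_apply_prodMk_right ((contDiffAt_mulChart hx).differentiableAt (by simp))]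
  set χ := extChartAt 𝓘(ℝ, E) (1 : G) with hχ
  have h1 : HasMFDerivAt 𝓘(ℝ, E) 𝓘(ℝ, E) χ.symm (χ 1) (chartDSymm (E := E) (1 : G) (χ 1)) :=
    hasMFDerivAt_extChartAt_symm (mem_extChartAt_target 1)
  rw [chartDSymm_self] at h1
  have h2 : HasMFDerivAt 𝓘(ℝ, E) 𝓘(ℝ, E) (fun z : G => χ.symm x * z) 1
      (mfderiv 𝓘(ℝ, E) 𝓘(ℝ, E) (fun z : G => χ.symm x * z) 1 : E →L[ℝ] E) :=
    ((contMDiff_mul_left (I := 𝓘(ℝ, E)) (n := ∞)).mdifferentiableAt (by simp)).hasMFDerivAt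
  have h3 := hasMFDerivAt_comp_of_eq h2 h1 (by simp [hχ])
  have h4 := hasMFDerivAt_comp_of_eq (hasMFDerivAt_extChartAt (χ.map_target hx)) h3
    (by simp [hχ])
  exact (congrArg (fun T : E →L[ℝ] E => T ξ) (hasFDerivAt_of_hasMFDerivAt h4).fderiv).symm

/-- The adjoint action, read in the chart around `1`, is a partial derivative of the conjugation. -/
theorem AdL_symm_apply {x : E} (hx : x ∈ (extChartAt 𝓘(ℝ, E) (1 : G)).target) (η : E) :
    (AdL ((extChartAt 𝓘(ℝ, E) (1 : G)).symm x) : E →L[ℝ] E) η =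
    fderiv ℝ (conjChart E G) (x, extChartAt 𝓘(ℝ, E) (1 : G) 1) (0, η) := by
  have : IsManifold 𝓘(ℝ, E) 1 G := isManifold_one
  rw [fderiv_apply_prodMk_right ((contDiffAt_conjChart hx).differentiableAt (by simp))]
  set χ := extChartAt 𝓘(ℝ, E) (1 : G) with hχ
  have h1 : HasMFDerivAt 𝓘(ℝ, E) 𝓘(ℝ, E) χ.symm (χ 1) (chartDSymm (E := E) (1 : G) (χ 1)) :=
    hasMFDerivAt_extChartAt_symm (mem_extChartAt_target 1)
  rw [chartDSymm_self] at h1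
  have h3 := hasMFDerivAt_comp_of_eq (hasMFDerivAt_conj (E := E) (χ.symm x)) h1 (by simp [hχ])
  have h0 : HasMFDerivAt 𝓘(ℝ, E) 𝓘(ℝ, E) χ 1 (chartD (E := E) (1 : G) 1) :=
    hasMFDerivAt_extChartAt (mem_extChartAt_source 1)
  rw [chartD_self] at h0
  have h4 := hasMFDerivAt_comp_of_eq h0 h3 (by simp [hχ])
  exact (congrArg (fun T : E →L[ℝ] E => T η) (hasFDerivAt_of_hasMFDerivAt h4).fderiv).symm

/-- The bracket of the Lie algebra as the antisymmetrized second derivative of the multiplication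
in the chart around `1`. -/
theorem bracket_eq_fderiv_mulChart (ξ η : GroupLieAlgebra 𝓘(ℝ, E) G) :
    (⁅ξ, η⁆ : GroupLieAlgebra 𝓘(ℝ, E) G) =
      (fderiv ℝ (fun x => fderiv ℝ (mulChart E G) (x, extChartAt 𝓘(ℝ, E) (1 : G) 1) (0, η))
          (extChartAt 𝓘(ℝ, E) (1 : G) 1) ξ
        - fderiv ℝ (fun x => fderiv ℝ (mulChart E G) (x, extChartAt 𝓘(ℝ, E) (1 : G) 1) (0, ξ))
          (extChartAt 𝓘(ℝ, E) (1 : G) 1) η : E) := by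
  have : IsManifold 𝓘(ℝ, E) 1 G := isManifold_one
  set χ := extChartAt 𝓘(ℝ, E) (1 : G) with hχ
  -- The left-invariant fields in the chart.
  let W : E → E → E := fun v => VectorField.mpullbackWithin 𝓘(ℝ, E) 𝓘(ℝ, E) χ.symm
    (mulInvariantVectorField (I := 𝓘(ℝ, E)) (G := G) v) univ
  have hpull (v : E) : W v =ᶠ[𝓝 (χ 1)] fun x => fderiv ℝ (mulChart E G) (x, χ 1) (0, v) := by
    filter_upwards [(isOpen_extChartAt_target (I := 𝓘(ℝ, E)) (1 : G)).mem_nhds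
      (mem_extChartAt_target 1)] with x hx
    rw [← chartD_mulInvariantVectorField hx]
    simp only [W, VectorField.mpullbackWithin_apply, mfderivWithin_univ]
    have h1 := chartD_comp_chartDSymm hx
    have h2 := chartDSymm_comp_chartD (χ.map_target hx)
    rw [χ.right_inv hx] at h2
    have h3 : (chartDSymm (E := E) (1 : G) x).inverse = chartD (1 : G) (χ.symm x) :=
      ContinuousLinearMap.inverse_eq h2 h1
    exact congrArg (fun T : E →L[ℝ] E =>
      T (mulInvariantVectorField (I := 𝓘(ℝ, E)) (G := G) v (χ.symm x))) h3
  have hunit (v : E) : fderiv ℝ (mulChart E G) (χ 1, χ 1) (0, v) = v := by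
    rw [fderiv_apply_prodMk_right ((contDiffAt_mulChart (mem_extChartAt_target 1)).differentiableAt
      (by simp))]
    have h1 : (fun y => mulChart E G (χ 1, y)) =ᶠ[𝓝 (χ 1)] id := by
      filter_upwards [(isOpen_extChartAt_target (I := 𝓘(ℝ, E)) (1 : G)).mem_nhds
        (mem_extChartAt_target 1)] with y hy
      simp only [mulChart, ← hχ, χ.left_inv (mem_extChartAt_source 1), one_mul, χ.right_inv hy,
        id_eq]
    rw [h1.fderiv_eq, fderiv_id]
    rfl
  have h3 : (chartD (E := E) (1 : G) 1).inverse = ContinuousLinearMap.id ℝ E := by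
    rw [chartD_self, ContinuousLinearMap.inverse_id]
  have h4 (v w : E) : (chartD (E := E) (1 : G) 1).inverse
      (VectorField.lieBracketWithin ℝ (W v) (W w) univ (χ 1)) =
      fderiv ℝ (fun x => fderiv ℝ (mulChart E G) (x, χ 1) (0, w)) (χ 1) v
        - fderiv ℝ (fun x => fderiv ℝ (mulChart E G) (x, χ 1) (0, v)) (χ 1) w := by
    rw [h3, VectorField.lieBracketWithin_univ,
      Filter.EventuallyEq.lieBracket_vectorField_eq (𝕜 := ℝ) (hpull v) (hpull w)]
    simp only [VectorField.lieBracket, hunit, ContinuousLinearMap.id_apply]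
  have h5 : (⁅ξ, η⁆ : GroupLieAlgebra 𝓘(ℝ, E) G) = (chartD (E := E) (1 : G) 1).inverse
      (VectorField.lieBracketWithin ℝ (W ξ) (W η) univ (χ 1)) := by
    rw [GroupLieAlgebra.bracket_def, ← VectorField.mlieBracketWithin_univ]
    unfold VectorField.mlieBracketWithin
    have hr : range (𝓘(ℝ, E) : E → E) = univ := range_id
    rw [hr, preimage_univ, univ_inter]
    rfl
  exact h5.trans (h4 ξ η)

/-- The derivative at `0` of `t ↦ Ad (exp (t ξ)) η` is the bracket `⁅ξ, η⁆`. -/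
theorem IsExpCurve.hasDerivAt_Ad {γ : ℝ → G} {ξ : GroupLieAlgebra 𝓘(ℝ, E) G}
    (h : IsExpCurve γ ξ) (η : GroupLieAlgebra 𝓘(ℝ, E) G) :
    HasDerivAt (fun t => (Ad (γ t) η : E)) (⁅ξ, η⁆ : GroupLieAlgebra 𝓘(ℝ, E) G) 0 := by
  have : IsManifold 𝓘(ℝ, E) 1 G := isManifold_one
  set χ := extChartAt 𝓘(ℝ, E) (1 : G) with hχ
  have hχ1 : χ.symm (χ 1) = 1 := by simp [hχ]
  have htarget : ∀ᶠ x in 𝓝 (χ 1), x ∈ χ.target :=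
    (isOpen_extChartAt_target (I := 𝓘(ℝ, E)) (1 : G)).mem_nhds (mem_extChartAt_target 1)
  have hFC : ∀ᶠ p in 𝓝 (χ 1, χ 1), mulChart E G (conjChart E G p, p.1) = mulChart E G p := by
    have hcont : ContinuousAt (fun p : E × E => χ.symm p.1 * χ.symm p.2 * (χ.symm p.1)⁻¹)
        (χ 1, χ 1) := by
      have := topologicalGroup_of_lieGroup 𝓘(ℝ, E) ∞ (G := G)
      have h1 : ContinuousAt χ.symm (χ 1) := continuousAt_extChartAt_symm (1 : G)
      have h2 : ContinuousAt (fun p : E × E => χ.symm p.1) (χ 1, χ 1) :=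
        ContinuousAt.comp (g := χ.symm) h1 continuousAt_fst
      have h3 : ContinuousAt (fun p : E × E => χ.symm p.2) (χ 1, χ 1) :=
        ContinuousAt.comp (g := χ.symm) h1 continuousAt_snd
      exact (h2.mul h3).mul h2.inv
    have hsrc : ∀ᶠ p in 𝓝 (χ 1, χ 1), χ.symm p.1 * χ.symm p.2 * (χ.symm p.1)⁻¹ ∈ χ.source := by
      refine hcont.eventually ((isOpen_extChartAt_source (1 : G)).mem_nhds ?_)
      simp [hχ]
    filter_upwards [hsrc] with p hp
    simp only [mulChart, conjChart, ← hχ, χ.left_inv hp]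
    simp
  obtain ⟨D, hD, hDeq⟩ := hasFDerivAt_local_adjoint (e := χ 1)
    ((contDiffAt_mulChart (mem_extChartAt_target 1)).of_le (WithTop.coe_le_coe.2 le_top))
    ((contDiffAt_conjChart (mem_extChartAt_target 1)).of_le (WithTop.coe_le_coe.2 le_top))
    (htarget.mono fun x hx => by simp only [mulChart, ← hχ, hχ1, mul_one, χ.right_inv hx])
    (htarget.mono fun x hx => by simp only [mulChart, ← hχ, hχ1, one_mul, χ.right_inv hx])
    (htarget.mono fun x hx => by simp only [conjChart, ← hχ, hχ1, mul_one, mul_inv_cancel]) hFC η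
  have hγ0 : HasMFDerivAt 𝓘(ℝ, E) 𝓘(ℝ, E) χ 1 (chartD (E := E) (1 : G) 1) :=
    hasMFDerivAt_extChartAt (mem_extChartAt_source 1)
  rw [chartD_self] at hγ0
  have hc : HasDerivAt (fun t => χ (γ t)) (ξ : E) 0 :=
    hasDerivAt_of_hasMFDerivAt (hasMFDerivAt_comp_of_eq hγ0 h.2.2 h.1)
  have hc0 : χ (γ 0) = χ 1 := by rw [h.1]
  have h5 : HasDerivAt (fun t => fderiv ℝ (conjChart E G) (χ (γ t), χ 1) (0, η)) (D ξ) 0 :=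
    HasFDerivAt.comp_hasDerivAt (0 : ℝ)
      (l := fun x => fderiv ℝ (conjChart E G) (x, χ 1) (0, η)) (by rw [hc0]; exact hD) hc
  have h6 : ∀ᶠ t in 𝓝 (0 : ℝ), γ t ∈ χ.source :=
    h.2.2.continuousAt.eventually ((isOpen_extChartAt_source (1 : G)).mem_nhds
      (by rw [h.1]; exact mem_extChartAt_source 1))
  have h7 : (fun t => (Ad (γ t) η : E)) =ᶠ[𝓝 0]
      fun t => fderiv ℝ (conjChart E G) (χ (γ t), χ 1) (0, η) := by
    filter_upwards [h6] with t ht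
    have := AdL_symm_apply (χ.map_source ht) η
    rw [χ.left_inv ht] at this
    exact this
  refine (h5.congr_of_eventuallyEq h7).congr_deriv ?_
  exact Eq.trans (hDeq ξ : D (ξ : E) = _) (bracket_eq_fderiv_mulChart ξ η).symm

end LieGroup

/-! ### The metric in a chart -/

section MetricInChart

variable {E : Type*} [NormedAddCommGroup E] [NormedSpace ℝ E]
  {M : Type*} [TopologicalSpace M] [ChartedSpace E M] [IsManifold 𝓘(ℝ, E) ∞ M]

/-- The metric at `x` as a bilinear form on the model space. -/
def metricAt (g : RiemannianMetric E M) (x : M) : E →L[ℝ] E →L[ℝ] ℝ := g.inner x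

theorem metricAt_symm (g : RiemannianMetric E M) (x : M) (v w : E) :
    metricAt g x v w = metricAt g x w v := g.symm x v w

theorem metricAt_pos (g : RiemannianMetric E M) (x : M) {v : E} (hv : v ≠ 0) :
    0 < metricAt g x v v := g.pos x v hv

/-- The coefficients of the metric in the chart around `a`, as a bilinear form. -/
def metricChart (g : RiemannianMetric E M) (a : M) (y : E) : E →L[ℝ] E →L[ℝ] ℝ :=
  (metricAt g ((extChartAt 𝓘(ℝ, E) a).symm y)).bilinearComp (chartDSymm a y) (chartDSymm a y)

theorem metricChart_apply (g : RiemannianMetric E M) (a : M) (y v w : E) :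
    metricChart g a y v w =
      metricAt g ((extChartAt 𝓘(ℝ, E) a).symm y) (chartDSymm a y v) (chartDSymm a y w) := rfl

theorem metricChart_symm (g : RiemannianMetric E M) (a : M) (y v w : E) :
    metricChart g a y v w = metricChart g a y w v := metricAt_symm g _ _ _

theorem metricChart_chartD (g : RiemannianMetric E M) {a x : M}
    (hx : x ∈ (extChartAt 𝓘(ℝ, E) a).source) (v w : E) :
    metricChart g a (extChartAt 𝓘(ℝ, E) a x) (chartD a x v) (chartD a x w) = metricAt g x v w := by
  have : IsManifold 𝓘(ℝ, E) 1 M := isManifold_one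
  have h (v : E) : chartDSymm a (extChartAt 𝓘(ℝ, E) a x) (chartD (E := E) a x v) = v :=
    congrArg (fun T : E →L[ℝ] E => T v) (chartDSymm_comp_chartD hx)
  rw [metricChart_apply, h, h, (extChartAt 𝓘(ℝ, E) a).left_inv hx]

theorem contDiffOn_metricChart [FiniteDimensional ℝ E] (g : RiemannianMetric E M) (a : M) :
    ContDiffOn ℝ ∞ (metricChart g a) (extChartAt 𝓘(ℝ, E) a).target := by
  have : IsManifold 𝓘(ℝ, E) 1 M := isManifold_one
  refine contDiffOn_clm_apply.2 fun v => contDiffOn_clm_apply.2 fun w => ?_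
  rw [← contMDiffOn_iff_contDiffOn]
  have hopen := isOpen_extChartAt_target (I := 𝓘(ℝ, E)) a
  have hsymm : ContMDiffOn 𝓘(ℝ, E) 𝓘(ℝ, E) ∞ (extChartAt 𝓘(ℝ, E) a).symm
      (extChartAt 𝓘(ℝ, E) a).target := contMDiffOn_extChartAt_symm a
  have hvec (v : E) : ContMDiffOn 𝓘(ℝ, E) 𝓘(ℝ, E).tangent ∞
      (fun y => (⟨(extChartAt 𝓘(ℝ, E) a).symm y, chartDSymm a y v⟩ : TangentBundle 𝓘(ℝ, E) M))
      (extChartAt 𝓘(ℝ, E) a).target := by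
    have h1 := hsymm.contMDiffOn_tangentMapWithin (m := ∞) (by simp) hopen.uniqueMDiffOn
    have h2 : ContMDiffOn 𝓘(ℝ, E) 𝓘(ℝ, E).tangent ∞
        (fun y : E => (⟨y, v⟩ : TangentBundle 𝓘(ℝ, E) E)) (extChartAt 𝓘(ℝ, E) a).target :=
      contMDiffOn_vectorSpace_iff_contDiffOn.2 contDiffOn_const
    refine (h1.comp h2 (fun y hy => hy)).congr fun y hy => ?_
    have h3 := tangentMapWithin_eq_tangentMap (I := 𝓘(ℝ, E)) (I' := 𝓘(ℝ, E))
      (f := (extChartAt 𝓘(ℝ, E) a).symm) (p := (⟨y, v⟩ : TangentBundle 𝓘(ℝ, E) E))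
      (hopen.uniqueMDiffWithinAt hy) (hasMFDerivAt_extChartAt_symm hy).mdifferentiableAt
    exact h3.symm
  intro y hy
  have : ContMDiffWithinAt 𝓘(ℝ, E) (𝓘(ℝ, E).prod 𝓘(ℝ)) ∞
      (fun m ↦ Bundle.TotalSpace.mk' ℝ (E := Bundle.Trivial M ℝ) ((extChartAt 𝓘(ℝ, E) a).symm m)
        (g.inner ((extChartAt 𝓘(ℝ, E) a).symm m) (chartDSymm a m v) (chartDSymm a m w)))
        (extChartAt 𝓘(ℝ, E) a).target y := by
    apply ContMDiffWithinAt.clm_bundle_apply₂ (F₁ := E) (F₂ := E)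
    · exact ContMDiffAt.comp_contMDiffWithinAt y g.contMDiff.contMDiffAt (hsymm y hy)
    · exact hvec v y hy
    · exact hvec w y hy
  simp only [Bundle.contMDiffWithinAt_totalSpace] at this
  exact this.2

end MetricInChart

/-! ### Fundamental fields of an isometric action and the Killing equation -/

section Action

variable {E E' : Type*} [NormedAddCommGroup E] [NormedSpace ℝ E]
  [NormedAddCommGroup E'] [NormedSpace ℝ E']
  {G : Type*} [TopologicalSpace G] [ChartedSpace E G] [Group G]
  {M : Type*} [TopologicalSpace M] [ChartedSpace E' M] [MulAction G M]

/-- The differential at `1` of the orbit map `a ↦ a • x`; its value at `ξ` is the value at `x` of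
the fundamental vector field of `ξ`. -/
def orbitD (E E' G : Type*) [NormedAddCommGroup E] [NormedSpace ℝ E]
    [NormedAddCommGroup E'] [NormedSpace ℝ E'] [TopologicalSpace G] [ChartedSpace E G] [Group G]
    {M : Type*} [TopologicalSpace M] [ChartedSpace E' M] [MulAction G M] (x : M) : E →L[ℝ] E' :=
  mfderiv 𝓘(ℝ, E) 𝓘(ℝ, E') (fun a : G => a • x) 1

theorem orbitD_add (x : M) (X Y : GroupLieAlgebra 𝓘(ℝ, E) G) :
    orbitD E E' G x (X + Y) = orbitD E E' G x X + orbitD E E' G x Y :=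
  (orbitD E E' G x).map_add X Y

/-- The differential at `x` of the action of `a`. -/
def smulD (E' : Type*) [NormedAddCommGroup E'] [NormedSpace ℝ E'] (a : G) (x : M)
    [ChartedSpace E' M] : E' →L[ℝ] E' :=
  mfderiv 𝓘(ℝ, E') 𝓘(ℝ, E') (fun y : M => a • y) x

theorem hasMFDerivAt_smul (hGM : ContMDiffSMul 𝓘(ℝ, E) 𝓘(ℝ, E') ∞ G M) (a : G) (x : M) :
    HasMFDerivAt 𝓘(ℝ, E') 𝓘(ℝ, E') (fun y : M => a • y) x (smulD E' a x) :=
  ((ContMDiffSMul.contMDiff_const_smul (I := 𝓘(ℝ, E)) (I' := 𝓘(ℝ, E')) (n := ∞) a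
    ).mdifferentiableAt (by simp)).hasMFDerivAt

theorem smulD_inv_smulD (hGM : ContMDiffSMul 𝓘(ℝ, E) 𝓘(ℝ, E') ∞ G M) (a : G) (x : M) (v : E') :
    smulD E' a⁻¹ (a • x) (smulD E' a x v) = v := by
  have h := hasMFDerivAt_comp_of_eq (hasMFDerivAt_smul hGM a⁻¹ (a • x))
    (hasMFDerivAt_smul hGM a x) rfl
  have h' : (fun z : M => a⁻¹ • a • z) = id := by ext z; simp
  rw [h'] at h
  exact congrArg (fun T : E' →L[ℝ] E' => T v) (hasMFDerivAt_unique h (hasMFDerivAt_id x))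

variable [hGM : ContMDiffSMul 𝓘(ℝ, E) 𝓘(ℝ, E') ∞ G M]

theorem hasMFDerivAt_orbit (x : M) :
    HasMFDerivAt 𝓘(ℝ, E) 𝓘(ℝ, E') (fun a : G => a • x) 1 (orbitD E E' G x) := by
  have h : ContMDiff 𝓘(ℝ, E) 𝓘(ℝ, E') ∞ (fun a : G => a • x) :=
    (contMDiff_smul (I := 𝓘(ℝ, E)) (I' := 𝓘(ℝ, E')) (n := ∞) (G := G) (M := M)).comp
      (contMDiff_id.prodMk contMDiff_const)
  exact (h.mdifferentiableAt (by simp)).hasMFDerivAt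

/-- The orbit of a point under a one-parameter subgroup is an integral curve of the fundamental
field. -/
theorem IsExpCurve.hasMFDerivAt_smul {γ : ℝ → G} {ξ : GroupLieAlgebra 𝓘(ℝ, E) G}
    (h : IsExpCurve γ ξ) (x : M) (t : ℝ) :
    HasMFDerivAt 𝓘(ℝ, ℝ) 𝓘(ℝ, E') (fun s => γ s • x) t
      (ContinuousLinearMap.toSpanSingleton ℝ (orbitD E E' G (γ t • x) ξ)) := by
  have h0 : HasMFDerivAt 𝓘(ℝ, ℝ) 𝓘(ℝ, ℝ) (fun s : ℝ => s - t) t (ContinuousLinearMap.id ℝ ℝ) :=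
    ((hasFDerivAt_id t).sub_const t).hasMFDerivAt
  have h1 := hasMFDerivAt_comp_of_eq h.2.2 h0 (sub_self t)
  have h2 := hasMFDerivAt_comp_of_eq (hasMFDerivAt_orbit (E := E) (E' := E') (G := G) (γ t • x)) h1
    (by simp [h.1])
  have h3 : (fun s => γ (s - t) • γ t • x) = fun s => γ s • x := by
    ext s; rw [← mul_smul, ← h.2.1, sub_add_cancel]
  rw [h3] at h2
  exact h2.congr_mfderiv (ContinuousLinearMap.comp_toSpanSingleton (orbitD E E' G (γ t • x)) ξ)

variable [LieGroup 𝓘(ℝ, E) ∞ G]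

theorem orbitD_smul_AdL (a : G) (x : M) (ξ : E) :
    orbitD E E' G (a • x) (AdL a ξ) = smulD E' a x (orbitD E E' G x ξ) := by
  have h1 := hasMFDerivAt_comp_of_eq (hasMFDerivAt_orbit (E := E) (E' := E') (G := G) (a • x))
    (hasMFDerivAt_conj (E := E) a) (by simp)
  have h2 := hasMFDerivAt_comp_of_eq (hasMFDerivAt_smul hGM a x)
    (hasMFDerivAt_orbit (E := E) (E' := E') (G := G) x) (one_smul G x)
  have h3 : (fun z : G => (a * z * a⁻¹) • a • x) = fun z => a • z • x := by
    ext z; simp [mul_smul]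
  rw [h3] at h1
  exact congrArg (fun T : E →L[ℝ] E' => T ξ) (hasMFDerivAt_unique h1 h2)

theorem orbitD_smul (a : G) (x : M) (ξ : E) :
    orbitD E E' G (a • x) ξ = smulD E' a x (orbitD E E' G x (AdL a⁻¹ ξ)) := by
  rw [← orbitD_smul_AdL]
  exact congrArg _ (Ad_Ad_inv a (ξ : GroupLieAlgebra 𝓘(ℝ, E) G)).symm

/-- The metric is invariant under `G`. -/
def IsInvariantUnder (G : Type*) [Group G] {M : Type*} [TopologicalSpace M] [ChartedSpace E' M]
    [IsManifold 𝓘(ℝ, E') ∞ M] [MulAction G M] (g : RiemannianMetric E' M) : Prop :=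
  ∀ (a : G) (x : M) (v w : E'),
    metricAt g (a • x) (smulD E' a x v) (smulD E' a x w) = metricAt g x v w

variable [IsManifold 𝓘(ℝ, E') ∞ M]

/-- The action of `G` on `M` in the charts around `1` and `a`. -/
def smulChart (E G : Type*) [NormedAddCommGroup E] [NormedSpace ℝ E] [TopologicalSpace G]
    [ChartedSpace E G] [Group G] {M : Type*} [TopologicalSpace M] [ChartedSpace E' M]
    [MulAction G M] (a : M) (p : E × E') : E' :=
  extChartAt 𝓘(ℝ, E') a
    ((extChartAt 𝓘(ℝ, E) (1 : G)).symm p.1 • (extChartAt 𝓘(ℝ, E') a).symm p.2)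

theorem contDiffAt_smulChart {a : M} {x : E} {y : E'}
    (hx : x ∈ (extChartAt 𝓘(ℝ, E) (1 : G)).target) (hy : y ∈ (extChartAt 𝓘(ℝ, E') a).target)
    (hxy : (extChartAt 𝓘(ℝ, E) (1 : G)).symm x • (extChartAt 𝓘(ℝ, E') a).symm y ∈
      (extChartAt 𝓘(ℝ, E') a).source) :
    ContDiffAt ℝ ∞ (smulChart E G a) (x, y) :=
  contDiffAt_read_in_charts (f := fun p : G × M => p.1 • p.2) contMDiff_smul 1 a a hx hy hxy

theorem contDiffAt_smulChart_one {a : M} {y : E'} (hy : y ∈ (extChartAt 𝓘(ℝ, E') a).target) :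
    ContDiffAt ℝ ∞ (smulChart E G a) (extChartAt 𝓘(ℝ, E) (1 : G) 1, y) :=
  contDiffAt_smulChart (mem_extChartAt_target 1) hy (by
    rw [(extChartAt 𝓘(ℝ, E) (1 : G)).left_inv (mem_extChartAt_source 1), one_smul]
    exact (extChartAt 𝓘(ℝ, E') a).map_target hy)

/-- A fundamental field in a chart is a partial derivative of the action. -/
theorem fderiv_smulChart_inl {a : M} {y : E'} (hy : y ∈ (extChartAt 𝓘(ℝ, E') a).target) (ξ : E) :
    fderiv ℝ (smulChart E G a) (extChartAt 𝓘(ℝ, E) (1 : G) 1, y) (ξ, 0) =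
      chartD a ((extChartAt 𝓘(ℝ, E') a).symm y)
        (orbitD E E' G ((extChartAt 𝓘(ℝ, E') a).symm y) ξ) := by
  have : IsManifold 𝓘(ℝ, E) 1 G := isManifold_one
  have : IsManifold 𝓘(ℝ, E') 1 M := isManifold_one
  rw [fderiv_apply_prodMk_left ((contDiffAt_smulChart_one hy).differentiableAt (by simp))]
  have h1 := hasMFDerivAt_extChartAt_symm (E := E) (mem_extChartAt_target (1 : G))
  rw [chartDSymm_self] at h1
  have h2 := hasMFDerivAt_comp_of_eq (hasMFDerivAt_orbit (E := E) (E' := E') (G := G)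
    ((extChartAt 𝓘(ℝ, E') a).symm y)) h1
    ((extChartAt 𝓘(ℝ, E) (1 : G)).left_inv (mem_extChartAt_source 1))
  have h3 := hasMFDerivAt_comp_of_eq (hasMFDerivAt_extChartAt (E := E')
    ((extChartAt 𝓘(ℝ, E') a).map_target hy)) h2
    (by rw [(extChartAt 𝓘(ℝ, E) (1 : G)).left_inv (mem_extChartAt_source 1), one_smul])
  exact congrArg (fun T : E →L[ℝ] E' => T ξ) (hasFDerivAt_of_hasMFDerivAt h3).fderiv

theorem fderiv_smulChart_inr {a : M} {x : E} {y : E'}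
    (hx : x ∈ (extChartAt 𝓘(ℝ, E) (1 : G)).target) (hy : y ∈ (extChartAt 𝓘(ℝ, E') a).target)
    (hxy : (extChartAt 𝓘(ℝ, E) (1 : G)).symm x • (extChartAt 𝓘(ℝ, E') a).symm y ∈
      (extChartAt 𝓘(ℝ, E') a).source) (v : E') :
    fderiv ℝ (smulChart E G a) (x, y) (0, v) =
      chartD a ((extChartAt 𝓘(ℝ, E) (1 : G)).symm x • (extChartAt 𝓘(ℝ, E') a).symm y)
        (smulD E' ((extChartAt 𝓘(ℝ, E) (1 : G)).symm x) ((extChartAt 𝓘(ℝ, E') a).symm y)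
          (chartDSymm a y v)) := by
  have : IsManifold 𝓘(ℝ, E') 1 M := isManifold_one
  rw [fderiv_apply_prodMk_right ((contDiffAt_smulChart hx hy hxy).differentiableAt (by simp))]
  have h2 := hasMFDerivAt_comp_of_eq (hasMFDerivAt_smul hGM
    ((extChartAt 𝓘(ℝ, E) (1 : G)).symm x) ((extChartAt 𝓘(ℝ, E') a).symm y))
    (hasMFDerivAt_extChartAt_symm hy) rfl
  have h3 := hasMFDerivAt_comp_of_eq (hasMFDerivAt_extChartAt (E := E') hxy) h2 rfl
  exact congrArg (fun T : E' →L[ℝ] E' => T v) (hasFDerivAt_of_hasMFDerivAt h3).fderiv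

/-- The Killing equation, on equal arguments, in a chart. -/
theorem killing_equation [FiniteDimensional ℝ E'] {g : RiemannianMetric E' M}
    (hg : IsInvariantUnder G g) {a : M} {y : E'} (hy : y ∈ (extChartAt 𝓘(ℝ, E') a).target)
    (ξ : E) (v : E') :
    fderiv ℝ (metricChart g a) y
        (fderiv ℝ (smulChart E G a) (extChartAt 𝓘(ℝ, E) (1 : G) 1, y) (ξ, 0)) v v
      + 2 * metricChart g a y v (fderiv ℝ
        (fun y' => fderiv ℝ (smulChart E G a) (extChartAt 𝓘(ℝ, E) (1 : G) 1, y') (ξ, 0)) y v) =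
      0 := by
  have : IsManifold 𝓘(ℝ, E') 1 M := isManifold_one
  set e := extChartAt 𝓘(ℝ, E) (1 : G) 1 with he
  set φ := extChartAt 𝓘(ℝ, E') a with hφ
  have hχe : (extChartAt 𝓘(ℝ, E) (1 : G)).symm e = 1 :=
    (extChartAt 𝓘(ℝ, E) (1 : G)).left_inv (mem_extChartAt_source 1)
  have hΨ : ContDiffAt ℝ ∞ (smulChart E G a) (e, y) := contDiffAt_smulChart_one hy
  have hΨ2 : ContDiffAt ℝ 2 (smulChart E G a) (e, y) :=
    hΨ.of_le (WithTop.coe_le_coe.2 le_top)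
  have hΨy : smulChart E G a (e, y) = y := by
    simp only [smulChart, hχe, one_smul, ← hφ, φ.right_inv hy]
  have hid (w : E') : fderiv ℝ (smulChart E G a) (e, y) (0, w) = w := by
    rw [fderiv_apply_prodMk_right (hΨ.differentiableAt (by simp))]
    have h1 : (fun y' => smulChart E G a (e, y')) =ᶠ[𝓝 y] id := by
      filter_upwards [(isOpen_extChartAt_target (I := 𝓘(ℝ, E')) a).mem_nhds hy] with y' hy'
      simp only [smulChart, hχe, one_smul, ← hφ, φ.right_inv hy', id_eq]
    rw [h1.fderiv_eq, fderiv_id]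
    rfl
  -- The invariance of the metric under the elements of `G` near `1`.
  have hinv : (fun x => metricChart g a (smulChart E G a (x, y))
      (fderiv ℝ (smulChart E G a) (x, y) (0, v)) (fderiv ℝ (smulChart E G a) (x, y) (0, v)))
      =ᶠ[𝓝 e] fun _ => metricChart g a y v v := by
    have hcont : ContinuousAt (fun x => (extChartAt 𝓘(ℝ, E) (1 : G)).symm x • φ.symm y) e := by
      have : ContinuousSMul G M := ContMDiffSMul.continuousSMul (I := 𝓘(ℝ, E)) (I' := 𝓘(ℝ, E')) ∞
      exact (continuousAt_extChartAt_symm (1 : G)).smul continuousAt_const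
    have hsrc : ∀ᶠ x in 𝓝 e, (extChartAt 𝓘(ℝ, E) (1 : G)).symm x • φ.symm y ∈ φ.source := by
      refine hcont.eventually ((isOpen_extChartAt_source a).mem_nhds ?_)
      simp only [hχe, one_smul]
      exact φ.map_target hy
    filter_upwards [hsrc, (isOpen_extChartAt_target (I := 𝓘(ℝ, E)) (1 : G)).mem_nhds
      (mem_extChartAt_target 1)] with x h1 h2
    rw [fderiv_smulChart_inr h2 hy h1, metricChart_apply g a y, ← hg
      ((extChartAt 𝓘(ℝ, E) (1 : G)).symm x) (φ.symm y)]
    exact metricChart_chartD g h1 _ _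
  have hG : HasFDerivAt (metricChart g a) (fderiv ℝ (metricChart g a) (smulChart E G a (e, y)))
      (smulChart E G a (e, y)) := by
    rw [hΨy]
    exact (((contDiffOn_metricChart g a).contDiffAt
      ((isOpen_extChartAt_target a).mem_nhds hy)).differentiableAt (by simp)).hasFDerivAt
  -- Differentiate it at `1` in the direction `ξ`; the mixed second derivative of the action that
  -- appears is the derivative of the fundamental field.
  have h1 := HasFDerivAt.comp e (g := metricChart g a) (f := fun x => smulChart E G a (x, y)) hG
      (HasFDerivAt.comp (g := smulChart E G a) (f := fun x' => (x', y)) e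
        (hΨ.differentiableAt (by simp)).hasFDerivAt (hasFDerivAt_prodMk_left e y))
  have h2 := (hasFDerivAt_fderiv_prodMk_left hΨ2).clm_apply (hasFDerivAt_const ((0 : E), v) e)
  have h3 := (h1.clm_apply h2).clm_apply h2
  have h4 := congrArg (fun T : E →L[ℝ] ℝ => T ξ)
    ((h3.congr_of_eventuallyEq hinv.symm).unique (hasFDerivAt_const _ e))
  have hz := (hasFDerivAt_fderiv_prodMk_right hΨ2).clm_apply (hasFDerivAt_const (ξ, (0 : E')) y)
  have hsymm : IsSymmSndFDerivAt ℝ (smulChart E G a) (e, y) := hΨ2.isSymmSndFDerivAt (by simp)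
  rw [hz.fderiv]
  simp [hid, hΨy] at h4 ⊢
  rw [hsymm.eq (0, v) (ξ, 0)]
  rw [metricChart_symm g a y _ v] at h4
  linarith

end Action

/-! ### Momenta of curves -/

section Momentum

variable {E E' : Type*} [NormedAddCommGroup E] [NormedSpace ℝ E]
  [NormedAddCommGroup E'] [NormedSpace ℝ E']
  {G : Type*} [TopologicalSpace G] [ChartedSpace E G] [Group G]
  {M : Type*} [TopologicalSpace M] [ChartedSpace E' M]

/-- The velocity of a curve as an element of the model space. -/
def vel (E' : Type*) [NormedAddCommGroup E'] [NormedSpace ℝ E'] {M : Type*} [TopologicalSpace M]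
    [ChartedSpace E' M] (c : ℝ → M) (t : ℝ) : E' :=
  velocity (E := E') c t

theorem hasMFDerivAt_vel {c : ℝ → M} {t : ℝ}
    (hc : MDifferentiableAt 𝓘(ℝ, ℝ) 𝓘(ℝ, E') c t) :
    HasMFDerivAt 𝓘(ℝ, ℝ) 𝓘(ℝ, E') c t (ContinuousLinearMap.toSpanSingleton ℝ (vel E' c t)) := by
  let T : ℝ →L[ℝ] E' := mfderiv 𝓘(ℝ, ℝ) 𝓘(ℝ, E') c t
  have hT : HasMFDerivAt 𝓘(ℝ, ℝ) 𝓘(ℝ, E') c t T := hc.hasMFDerivAt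
  exact hT.congr_mfderiv (ContinuousLinearMap.toSpanSingleton_apply_map_one ℝ T).symm

theorem vel_eq {c : ℝ → M} {t : ℝ} {v : E'} (hc : HasMFDerivAt 𝓘(ℝ, ℝ) 𝓘(ℝ, E') c t
    (ContinuousLinearMap.toSpanSingleton ℝ v)) : vel E' c t = v := by
  have h : ContinuousLinearMap.toSpanSingleton ℝ (vel E' c t) =
      ContinuousLinearMap.toSpanSingleton ℝ v :=
    hasMFDerivAt_unique (hasMFDerivAt_vel hc.mdifferentiableAt) hc
  have h1 := congrArg (fun T : ℝ →L[ℝ] E' => T 1) h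
  simpa only [ContinuousLinearMap.toSpanSingleton_apply_one] using h1

/-- Conservation of momentum in coordinates: the field `z` satisfies, at the point `u t` and on
equal arguments, the Killing equation of the metric with coefficients `B`. The derivative is the
expression that defines the covariant acceleration. -/
theorem hasDerivAt_killing_pairing {B : E' → E' →L[ℝ] E' →L[ℝ] ℝ} {z : E' → E'} {u : ℝ → E'}
    {t : ℝ} {u' u'' : E'} (hB : DifferentiableAt ℝ B (u t)) (hz : DifferentiableAt ℝ z (u t))
    (hu : HasDerivAt u u' t) (hu' : HasDerivAt (deriv u) u'' t)
    (hk : fderiv ℝ B (u t) (z (u t)) u' u' + 2 * B (u t) u' (fderiv ℝ z (u t) u') = 0) :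
    HasDerivAt (fun s => B (u s) (deriv u s) (z (u s)))
      (B (u t) u'' (z (u t)) + fderiv ℝ (fun y => B y u' (z (u t))) (u t) u'
        - 1 / 2 * fderiv ℝ (fun y => B y u' u') (u t) (z (u t))) t := by
  have h1 : HasDerivAt (fun s => B (u s)) (fderiv ℝ B (u t) u') t :=
    HasFDerivAt.comp_hasDerivAt (l := B) t hB.hasFDerivAt hu
  have h2 : HasDerivAt (fun s => z (u s)) (fderiv ℝ z (u t) u') t :=
    HasFDerivAt.comp_hasDerivAt (l := z) t hz.hasFDerivAt hu
  have h3 : HasDerivAt (fun s => B (u s) (deriv u s))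
      (fderiv ℝ B (u t) u' (deriv u t) + B (u t) u'') t := h1.clm_apply hu'
  refine (h3.clm_apply h2).congr_deriv ?_
  have hBvw (v w x : E') : fderiv ℝ (fun y => B y v w) (u t) x = fderiv ℝ B (u t) x v w := by
    have h := (hB.hasFDerivAt.clm_apply (hasFDerivAt_const v (u t))).clm_apply
      (hasFDerivAt_const w (u t))
    rw [h.fderiv]
    simp
  rw [hBvw, hBvw]
  simp only [hu.deriv, add_apply]
  linarith

variable [IsManifold 𝓘(ℝ, E') ∞ M]

theorem hasDerivAt_chart_comp {c : ℝ → M} {t : ℝ} {v : E'} {a : M}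
    (hc : HasMFDerivAt 𝓘(ℝ, ℝ) 𝓘(ℝ, E') c t (ContinuousLinearMap.toSpanSingleton ℝ v))
    (ha : c t ∈ (extChartAt 𝓘(ℝ, E') a).source) :
    HasDerivAt (fun s => extChartAt 𝓘(ℝ, E') a (c s)) (chartD a (c t) v) t := by
  have : IsManifold 𝓘(ℝ, E') 1 M := isManifold_one
  have h := hasMFDerivAt_comp_of_eq (hasMFDerivAt_extChartAt ha) hc rfl
  exact hasDerivAt_of_hasMFDerivAt (h.congr_mfderiv
    (ContinuousLinearMap.comp_toSpanSingleton (chartD a (c t)) v))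

variable [MulAction G M] [hGM : ContMDiffSMul 𝓘(ℝ, E) 𝓘(ℝ, E') ∞ G M] [LieGroup 𝓘(ℝ, E) ∞ G]

/-- Conservation of momentum: the derivative of the pairing of the velocity of a curve with the
fundamental field of `ξ` is the pairing of the covariant acceleration with that field. -/
theorem hasDerivAt_momentum [FiniteDimensional ℝ E'] {g : RiemannianMetric E' M}
    (hg : IsInvariantUnder G g) {c : ℝ → M} {t : ℝ}
    (hc : ContMDiffAt 𝓘(ℝ, ℝ) 𝓘(ℝ, E') 2 c t) {a : M}
    (ha : c t ∈ (extChartAt 𝓘(ℝ, E') a).source) (ξ : E) :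
    HasDerivAt (fun s => metricAt g (c s) (vel E' c s) (orbitD E E' G (c s) ξ))
      (covariantAcceleration g c a t (chartD a (c t) (orbitD E E' G (c t) ξ))) t := by
  have : IsManifold 𝓘(ℝ, E') 1 M := isManifold_one
  set φ := extChartAt 𝓘(ℝ, E') a with hφ
  set u : ℝ → E' := fun s => φ (c s) with hu
  set e := extChartAt 𝓘(ℝ, E) (1 : G) 1 with he
  -- The fundamental field of `ξ` in the chart.
  set z : E' → E' := fun y => fderiv ℝ (smulChart E G a) (e, y) (ξ, 0) with hz
  have hzu {s : ℝ} (hs : c s ∈ φ.source) : z (u s) = chartD a (c s) (orbitD E E' G (c s) ξ) := by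
    have h := fderiv_smulChart_inl (E := E) (G := G) (φ.map_source hs) ξ
    rw [φ.left_inv hs] at h
    exact h
  have hut : u t ∈ φ.target := φ.map_source ha
  have hsrc : ∀ᶠ s in 𝓝 t, c s ∈ φ.source :=
    hc.continuousAt.eventually ((isOpen_extChartAt_source a).mem_nhds ha)
  have hdiff : ∀ᶠ s in 𝓝 t, MDifferentiableAt 𝓘(ℝ, ℝ) 𝓘(ℝ, E') c s :=
    by
    have h1 : IsManifold 𝓘(ℝ, E') 2 M := IsManifold.of_le (n := ∞) (WithTop.coe_le_coe.2 le_top)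
    exact ((contMDiffAt_iff_contMDiffAt_nhds (by simp)).1 hc).mono
      fun s hs => hs.mdifferentiableAt (by simp)
  have hu2 : ContDiffAt ℝ 2 u t := by
    rw [← contMDiffAt_iff_contDiffAt]
    exact ContMDiffAt.comp t ((contMDiffAt_extChartAt' (n := ∞)
      (by rwa [hφ, extChartAt_source] at ha)).of_le (WithTop.coe_le_coe.2 le_top)) hc
  have hderiv {s : ℝ} (hs : c s ∈ φ.source) (hs' : MDifferentiableAt 𝓘(ℝ, ℝ) 𝓘(ℝ, E') c s) :
      deriv u s = chartD a (c s) (vel E' c s) :=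
    (hasDerivAt_chart_comp (hasMFDerivAt_vel hs') hs).deriv
  have hGd : DifferentiableAt ℝ (metricChart g a) (u t) :=
    ((contDiffOn_metricChart g a).contDiffAt
      ((isOpen_extChartAt_target a).mem_nhds hut)).differentiableAt (by simp)
  have hzd : DifferentiableAt ℝ z (u t) :=
    ((hasFDerivAt_fderiv_prodMk_right
      ((contDiffAt_smulChart_one (E := E) (G := G) hut).of_le
      (m := 2) (WithTop.coe_le_coe.2 le_top))).clm_apply
      (hasFDerivAt_const (ξ, (0 : E')) (u t))).differentiableAt
  have hu1 : HasDerivAt u (deriv u t) t := (hu2.differentiableAt (by simp)).hasDerivAt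
  have hu3 : HasDerivAt (deriv u) (deriv (deriv u) t) t := by
    have h : ContDiffAt ℝ 1 (deriv u) t := 
      (hu2.fderiv_right (m := 1) (by norm_num)).clm_apply contDiffAt_const
    exact (h.differentiableAt (by simp)).hasDerivAt
  have hloc : (fun s => metricAt g (c s) (vel E' c s) (orbitD E E' G (c s) ξ)) =ᶠ[𝓝 t]
      fun s => metricChart g a (u s) (deriv u s) (z (u s)) := by
    filter_upwards [hsrc, hdiff] with s h1 h2
    rw [hderiv h1 h2, hzu h1]
    exact (metricChart_chartD g h1 _ _).symm
  rw [← hzu ha]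
  exact (hasDerivAt_killing_pairing hGd hzd hu1 hu3
    (killing_equation hg hut ξ (deriv u t))).congr_of_eventuallyEq hloc

/-- The curves with given momenta are the integral curves of a vector field that is smooth near
each point, so that they are locally determined by an initial point. -/
theorem eventuallyEq_of_momentum_eq [FiniteDimensional ℝ E] [FiniteDimensional ℝ E']
    {g : RiemannianMetric E' M} (hsurj : ∀ x : M, Function.Surjective (orbitD E E' G x))
    {c₁ c₂ : ℝ → M} {v₁ v₂ : ℝ → E'} {t₀ : ℝ}
    (h₁ : ∀ᶠ t in 𝓝 t₀, HasMFDerivAt 𝓘(ℝ, ℝ) 𝓘(ℝ, E') c₁ t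
      (ContinuousLinearMap.toSpanSingleton ℝ (v₁ t)))
    (h₂ : ∀ᶠ t in 𝓝 t₀, HasMFDerivAt 𝓘(ℝ, ℝ) 𝓘(ℝ, E') c₂ t
      (ContinuousLinearMap.toSpanSingleton ℝ (v₂ t))) {p : E → ℝ}
    (hp₁ : ∀ᶠ t in 𝓝 t₀, ∀ ξ, metricAt g (c₁ t) (v₁ t) (orbitD E E' G (c₁ t) ξ) = p ξ)
    (hp₂ : ∀ᶠ t in 𝓝 t₀, ∀ ξ, metricAt g (c₂ t) (v₂ t) (orbitD E E' G (c₂ t) ξ) = p ξ)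
    (h0 : c₁ t₀ = c₂ t₀) : c₁ =ᶠ[𝓝 t₀] c₂ := by
  have : IsManifold 𝓘(ℝ, E') 1 M := isManifold_one
  set a := c₁ t₀ with ha
  set φ := extChartAt 𝓘(ℝ, E') a with hφ
  set e := extChartAt 𝓘(ℝ, E) (1 : G) 1 with he
  set y₀ := φ a with hy₀
  have hy₀t : y₀ ∈ φ.target := mem_extChartAt_target a
  -- `A y w` is the momentum of the tangent vector `w` at the point with coordinate `y`.
  let Z : E' → E →L[ℝ] E' := fun y =>
    (fderiv ℝ (smulChart E G a) (e, y)).comp (ContinuousLinearMap.inl ℝ E E')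
  let A : E' → E' →L[ℝ] E →L[ℝ] ℝ := fun y =>
    ((ContinuousLinearMap.compL ℝ E E' ℝ).flip (Z y)).comp (metricChart g a y)
  have hA (x : M) (hx : x ∈ φ.source) (v : E') (ξ : E) :
      A (φ x) (chartD a x v) ξ = metricAt g x v (orbitD E E' G x ξ) := by
    have h := fderiv_smulChart_inl (E := E) (G := G) (φ.map_source hx) ξ
    rw [φ.left_inv hx] at h
    rw [← metricChart_chartD g hx, ← h]
    simp [A, Z, hφ, he]
  have hAd : ContDiffAt ℝ 1 A y₀ := by
    have h1 : ContDiffAt ℝ 1 (metricChart g a) y₀ := ((contDiffOn_metricChart g a).contDiffAt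
      ((isOpen_extChartAt_target a).mem_nhds hy₀t)).of_le (by simp)
    have h2 : ContDiffAt ℝ 1 (fderiv ℝ (smulChart E G a)) (e, y₀) :=
      (contDiffAt_smulChart_one hy₀t).fderiv_right (WithTop.coe_le_coe.2 le_top)
    have h3 : ContDiffAt ℝ 1 Z y₀ :=
      (ContDiffAt.comp y₀ (f := fun y => (e, y)) h2
        (contDiffAt_const.prodMk contDiffAt_id)).clm_comp contDiffAt_const
    exact (((ContinuousLinearMap.compL ℝ E E' ℝ).flip.contDiff.contDiffAt).comp y₀ h3).clm_comp h1
  have hAinj : Function.Injective (A y₀) := by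
    rw [injective_iff_map_eq_zero]
    intro w hw
    by_contra hne
    obtain ⟨ξ, hξ⟩ := hsurj a w
    have h1 := hA a (mem_extChartAt_source a) w ξ
    rw [chartD_self, hξ] at h1
    have h2 := metricAt_pos g a hne
    rw [← h1] at h2
    simp only [ContinuousLinearMap.id_apply, ← hy₀, hw] at h2
    simp at h2
  -- With a left inverse `L` of `A y₀`, the endomorphism `L ∘ A y` is invertible for `y` near `y₀`.
  obtain ⟨L, hL⟩ := LinearMap.exists_leftInverse_of_injective (A y₀ : E' →ₗ[ℝ] E →L[ℝ] ℝ)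
    (LinearMap.ker_eq_bot.2 hAinj)
  let B : E' → E' →L[ℝ] E' := fun y => (LinearMap.toContinuousLinearMap L).comp (A y)
  have hB0 : B y₀ = 1 := by
    ext w
    exact congrArg (fun T : E' →ₗ[ℝ] E' => T w) hL
  have hBd : ContDiffAt ℝ 1 B y₀ := contDiffAt_const.clm_comp hAd
  -- The momentum `p`, as a linear form on the Lie algebra.
  let P : E →L[ℝ] ℝ := A y₀ (chartD a a (v₁ t₀))
  have hP (ξ : E) : P ξ = p ξ :=
    (hA a (mem_extChartAt_source a) (v₁ t₀) ξ).trans (hp₁.self_of_nhds ξ)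
  -- The vector field whose integral curves have momentum `p`.
  let V : E' → E' := fun y => Ring.inverse (B y) (L P)
  have hVd : ContDiffAt ℝ 1 V y₀ := by
    have h1 : ContDiffAt ℝ 1 Ring.inverse (B y₀) := by
      rw [hB0]
      exact contDiffAt_ringInverse ℝ (1 : (E' →L[ℝ] E')ˣ)
    exact (h1.comp y₀ hBd).clm_apply contDiffAt_const
  obtain ⟨k, s, hs, hlip⟩ := hVd.exists_lipschitzOnWith
  have hunit : ∀ᶠ y in 𝓝 y₀, IsUnit (B y) := by
    refine hBd.continuousAt.eventually (Units.isOpen.mem_nhds ?_)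
    rw [hB0]
    exact isUnit_one
  have hode (c : ℝ → M) (v : ℝ → E') (hc0 : c t₀ = a)
      (hc : ∀ᶠ t in 𝓝 t₀, HasMFDerivAt 𝓘(ℝ, ℝ) 𝓘(ℝ, E') c t
        (ContinuousLinearMap.toSpanSingleton ℝ (v t)))
      (hp : ∀ᶠ t in 𝓝 t₀, ∀ ξ, metricAt g (c t) (v t) (orbitD E E' G (c t) ξ) = p ξ) :
      (∀ᶠ t in 𝓝 t₀, c t ∈ φ.source) ∧
      ∀ᶠ t in 𝓝 t₀, HasDerivAt (fun t => φ (c t)) (V (φ (c t))) t ∧ φ (c t) ∈ s := by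
    have hcont : ContinuousAt c t₀ := hc.self_of_nhds.continuousAt
    have hsrc : ∀ᶠ t in 𝓝 t₀, c t ∈ φ.source :=
      hcont.eventually ((isOpen_extChartAt_source a).mem_nhds
        (by rw [hc0]; exact mem_extChartAt_source a))
    have hcont2 : Filter.Tendsto (fun t => φ (c t)) (𝓝 t₀) (𝓝 y₀) := by
      refine Filter.Tendsto.comp (continuousAt_extChartAt (I := 𝓘(ℝ, E')) a).tendsto ?_
      rw [← hc0]
      exact hcont.tendsto
    refine ⟨hsrc, ?_⟩
    filter_upwards [hsrc, hc, hp, hcont2.eventually hunit, hcont2.eventually hs]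
      with t h1 h2 h3 h4 h5
    refine ⟨(hasDerivAt_chart_comp h2 h1).congr_deriv ?_, h5⟩
    have h6 : A (φ (c t)) (chartD a (c t) (v t)) = P := by
      ext ξ
      rw [hA _ h1, h3, hP]
    have h7 : B (φ (c t)) (chartD a (c t) (v t)) = L P := by
      rw [← h6]; rfl
    change _ = Ring.inverse (B (φ (c t))) (L P)
    rw [← h7]
    exact (congrArg (fun T : E' →L[ℝ] E' => T (chartD a (c t) (v t)))
      (Ring.inverse_mul_cancel _ h4)).symm
  obtain ⟨hs1, hd1⟩ := hode c₁ v₁ rfl h₁ hp₁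
  obtain ⟨hs2, hd2⟩ := hode c₂ v₂ h0.symm h₂ hp₂
  have heq := ODE_solution_unique_of_eventually (v := fun _ => V) (s := fun _ => s)
    (Filter.Eventually.of_forall fun _ => hlip) hd1 hd2 (by rw [← h0])
  filter_upwards [heq, hs1, hs2] with t h1 h2 h3
  rw [← φ.left_inv h2, h1, φ.left_inv h3]

/-- Two curves with the same constant momenta and a common point agree on an interval. -/
theorem eqOn_of_momentum_eq [FiniteDimensional ℝ E] [FiniteDimensional ℝ E'] [T2Space M]
    {g : RiemannianMetric E' M} (hsurj : ∀ x : M, Function.Surjective (orbitD E E' G x))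
    {c₁ c₂ : ℝ → M} {v₁ v₂ : ℝ → E'} {J : Set ℝ} (hJ : IsOpen J) (hJc : J.OrdConnected)
    (h₁ : ∀ t ∈ J, HasMFDerivAt 𝓘(ℝ, ℝ) 𝓘(ℝ, E') c₁ t
      (ContinuousLinearMap.toSpanSingleton ℝ (v₁ t)))
    (h₂ : ∀ t ∈ J, HasMFDerivAt 𝓘(ℝ, ℝ) 𝓘(ℝ, E') c₂ t
      (ContinuousLinearMap.toSpanSingleton ℝ (v₂ t))) {p : E → ℝ}
    (hp₁ : ∀ t ∈ J, ∀ ξ, metricAt g (c₁ t) (v₁ t) (orbitD E E' G (c₁ t) ξ) = p ξ)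
    (hp₂ : ∀ t ∈ J, ∀ ξ, metricAt g (c₂ t) (v₂ t) (orbitD E E' G (c₂ t) ξ) = p ξ)
    {t₀ : ℝ} (ht₀ : t₀ ∈ J) (h0 : c₁ t₀ = c₂ t₀) : EqOn c₁ c₂ J := by
  have hsub : J ⊆ {t | t ∈ J ∧ c₁ t = c₂ t} := by
    refine hJc.isPreconnected.subset_of_closure_inter_subset ?_ ⟨t₀, ht₀, ht₀, h0⟩ ?_
    · rw [isOpen_iff_mem_nhds]
      rintro t ⟨ht, hct⟩
      have hJt := hJ.mem_nhds ht
      have := eventuallyEq_of_momentum_eq hsurj (Filter.mem_of_superset hJt h₁)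
        (Filter.mem_of_superset hJt h₂) (Filter.mem_of_superset hJt hp₁)
        (Filter.mem_of_superset hJt hp₂) hct
      filter_upwards [this, hJt] with s h1 h2 using ⟨h2, h1⟩
    · rintro t ⟨htc, ht⟩
      refine ⟨ht, ?_⟩
      have : (𝓝[{t | t ∈ J ∧ c₁ t = c₂ t}] t).NeBot := mem_closure_iff_nhdsWithin_neBot.1 htc
      have l1 := (h₁ t ht).continuousAt.tendsto.mono_left
        (nhdsWithin_le_nhds (s := {t | t ∈ J ∧ c₁ t = c₂ t}))
      have l2 := (h₂ t ht).continuousAt.tendsto.mono_left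
        (nhdsWithin_le_nhds (s := {t | t ∈ J ∧ c₁ t = c₂ t}))
      refine tendsto_nhds_unique (l1.congr' ?_) l2
      filter_upwards [self_mem_nhdsWithin] with s hs using hs.2
  exact fun t ht => (hsub ht).2

end Momentum

/-! ### The homogeneous space `G/H` -/

section LieAlgebra

variable {E : Type*} [NormedAddCommGroup E] [NormedSpace ℝ E]
  {G : Type*} [TopologicalSpace G] [ChartedSpace E G] [Group G] [LieGroup 𝓘(ℝ, E) ∞ G]

/-- Mathlib's Lie ring structure on the Lie algebra of `G` asks for smoothness `minSmoothness ℝ 3`;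
this lemma and the following ones transfer it to a smooth Lie group. -/
theorem bracket_add [CompleteSpace E] (X Y Z : GroupLieAlgebra 𝓘(ℝ, E) G) :
    ⁅X, Y + Z⁆ = ⁅X, Y⁆ + ⁅X, Z⁆ := by
  have := lieGroup_minSmoothness (E := E) (G := G)
  exact lie_add X Y Z

theorem add_bracket [CompleteSpace E] (X Y Z : GroupLieAlgebra 𝓘(ℝ, E) G) :
    ⁅X + Y, Z⁆ = ⁅X, Z⁆ + ⁅Y, Z⁆ := by
  have := lieGroup_minSmoothness (E := E) (G := G)
  exact add_lie X Y Z

theorem neg_bracket [CompleteSpace E] (X Y : GroupLieAlgebra 𝓘(ℝ, E) G) :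
    -⁅Y, X⁆ = ⁅X, Y⁆ := by
  have := lieGroup_minSmoothness (E := E) (G := G)
  exact lie_skew X Y

theorem bracket_self [CompleteSpace E] (X : GroupLieAlgebra 𝓘(ℝ, E) G) : ⁅X, X⁆ = 0 := by
  have := lieGroup_minSmoothness (E := E) (G := G)
  exact lie_self X

theorem mem_lieAlg_top [T2Space G] [CompleteSpace E] (X : GroupLieAlgebra 𝓘(ℝ, E) G) :
    X ∈ lieAlg (⊤ : Subgroup G) := by
  obtain ⟨γ, hγ⟩ := exists_isExpCurve X
  exact ⟨γ, hγ, fun _ => Subgroup.mem_top _⟩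

theorem Ad_mem_lieAlg {K : Subgroup G} {k : G} (hk : k ∈ K) {X : GroupLieAlgebra 𝓘(ℝ, E) G}
    (hX : X ∈ lieAlg K) : Ad k X ∈ lieAlg K := by
  obtain ⟨γ, hγ, hγK⟩ := hX
  exact ⟨_, hγ.conj k, fun t => K.mul_mem (K.mul_mem hk (hγK t)) (K.inv_mem hk)⟩

theorem IsExpCurve.mem_of_mem_lieAlg [T2Space G] {K : Subgroup G} {γ : ℝ → G}
    {X : GroupLieAlgebra 𝓘(ℝ, E) G} (hγ : IsExpCurve γ X) (hX : X ∈ lieAlg K) (t : ℝ) :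
    γ t ∈ K := by
  obtain ⟨γ', hγ', hK⟩ := hX
  rw [hγ.unique hγ']
  exact hK t

theorem IsExpCurve.Ad_self {γ : ℝ → G} {ξ : GroupLieAlgebra 𝓘(ℝ, E) G} (hγ : IsExpCurve γ ξ)
    (t : ℝ) : Ad (γ t) ξ = ξ := by
  have h1 := hγ.conj (γ t)
  have h2 : (fun s => γ t * γ s * (γ t)⁻¹) = γ := by
    ext s
    rw [← hγ.neg_apply, ← hγ.2.1, ← hγ.2.1]
    congr 1
    ring
  rw [h2] at h1
  exact (vel_eq (E' := E) h1.2.2).symm.trans (vel_eq (E' := E) hγ.2.2)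

end LieAlgebra

section Cosets

variable {G : Type*} [Group G] {H K : Subgroup G}

theorem mk_eq_smul_one (a : G) : (a : G ⧸ H) = a • ((1 : G) : G ⧸ H) := by
  rw [MulAction.Quotient.smul_coe, smul_eq_mul, mul_one]

theorem mk_mul_eq_conj_smul (k a : G) :
    ((k * a : G) : G ⧸ H) = (k * a * k⁻¹) • (k : G ⧸ H) := by
  rw [MulAction.Quotient.smul_coe, smul_eq_mul, inv_mul_cancel_right]

theorem mem_fiber_iff {hHK : H ≤ K} {x : G ⧸ H} : x ∈ fiber hHK ↔ ∃ k ∈ K, x = (k : G ⧸ H) := by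
  constructor
  · induction x using QuotientGroup.induction_on with | _ a
    intro hx
    refine ⟨a, ?_, rfl⟩
    have h : (a : G ⧸ K) = ((1 : G) : G ⧸ K) := hx
    simpa using QuotientGroup.eq.1 h.symm
  · rintro ⟨k, hk, rfl⟩
    have h : (k : G ⧸ K) = ((1 : G) : G ⧸ K) := QuotientGroup.eq.2 (by simpa using K.inv_mem hk)
    exact h

end Cosets

section Homogeneous

variable {E E' : Type*} [NormedAddCommGroup E] [NormedSpace ℝ E]
  [NormedAddCommGroup E'] [NormedSpace ℝ E']
  {G : Type*} [TopologicalSpace G] [ChartedSpace E G] [Group G]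
  {H K : Subgroup G} [ChartedSpace E' (G ⧸ H)]

theorem t2Space_quotient [IsTopologicalGroup G] (hH : IsClosed (H : Set G)) :
    T2Space (G ⧸ H) := by
  rw [t2Space_iff_of_isOpenQuotientMap (QuotientGroup.isOpenQuotientMap_mk (N := H))]
  have h : {q : G × G | (q.1 : G ⧸ H) = (q.2 : G ⧸ H)} = (fun q : G × G => q.1⁻¹ * q.2) ⁻¹' H := by
    ext q; exact QuotientGroup.eq
  rw [h]
  exact hH.preimage (continuous_fst.inv.mul continuous_snd)

theorem orbitD_base (hM : IsHomogeneousManifold E E' H) :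
    orbitD E E' G ((1 : G) : G ⧸ H) =
      (mfderiv 𝓘(ℝ, E) 𝓘(ℝ, E') (QuotientGroup.mk : G → G ⧸ H) 1 : E →L[ℝ] E') := by
  have := hM.smooth_smul
  have h := hasMFDerivAt_orbit (E := E) (E' := E') (G := G) ((1 : G) : G ⧸ H)
  have h1 : (fun a : G => a • ((1 : G) : G ⧸ H)) = QuotientGroup.mk := by
    ext a; exact (mk_eq_smul_one a).symm
  rw [h1] at h
  exact h.mfderiv.symm

theorem basePointForm_eq [IsManifold 𝓘(ℝ, E') ∞ (G ⧸ H)] (hM : IsHomogeneousManifold E E' H)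
    (ds : RiemannianMetric E' (G ⧸ H)) (X Y : GroupLieAlgebra 𝓘(ℝ, E) G) :
    basePointForm ds X Y = metricAt ds ((1 : G) : G ⧸ H) (orbitD E E' G ((1 : G) : G ⧸ H) X)
      (orbitD E E' G ((1 : G) : G ⧸ H) Y) := by
  rw [orbitD_base hM]
  rfl

theorem basePointForm_symm [IsManifold 𝓘(ℝ, E') ∞ (G ⧸ H)]
    (ds : RiemannianMetric E' (G ⧸ H)) (X Y : GroupLieAlgebra 𝓘(ℝ, E) G) :
    basePointForm ds X Y = basePointForm ds Y X := ds.symm _ _ _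

theorem orbitD_base_eq_zero (hM : IsHomogeneousManifold E E' H)
    {X : GroupLieAlgebra 𝓘(ℝ, E) G} (hX : X ∈ lieAlg H) :
    orbitD E E' G ((1 : G) : G ⧸ H) X = 0 := by
  have := hM.smooth_smul
  obtain ⟨γ, hγ, hγH⟩ := hX
  have h := hγ.hasMFDerivAt_smul (E' := E') ((1 : G) : G ⧸ H) 0
  rw [hγ.1, one_smul] at h
  have h1 : (fun s => γ s • ((1 : G) : G ⧸ H)) = fun _ => ((1 : G) : G ⧸ H) := by
    ext s
    rw [← mk_eq_smul_one]
    exact QuotientGroup.eq.2 (by simpa using H.inv_mem (hγH s))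
  rw [h1] at h
  have h2 : ContinuousLinearMap.toSpanSingleton ℝ (orbitD E E' G ((1 : G) : G ⧸ H) X) = 0 :=
    hasMFDerivAt_unique h (hasMFDerivAt_const _ _)
  have h3 := congrArg (fun T : ℝ →L[ℝ] E' => T 1) h2
  simpa only [ContinuousLinearMap.toSpanSingleton_apply_one, zero_apply] using h3

theorem basePointForm_eq_zero [IsManifold 𝓘(ℝ, E') ∞ (G ⧸ H)] (hM : IsHomogeneousManifold E E' H)
    (ds : RiemannianMetric E' (G ⧸ H)) (X : GroupLieAlgebra 𝓘(ℝ, E) G)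
    {Y : GroupLieAlgebra 𝓘(ℝ, E) G} (hY : Y ∈ lieAlg H) : basePointForm ds X Y = 0 := by
  rw [basePointForm_eq hM, orbitD_base_eq_zero hM hY, map_zero]

theorem orbitD_surjective [LieGroup 𝓘(ℝ, E) ∞ G] (hM : IsHomogeneousManifold E E' H) (x : G ⧸ H) :
    Function.Surjective (orbitD E E' G x) := by
  have := hM.smooth_smul
  induction x using QuotientGroup.induction_on with | _ a
  intro v
  obtain ⟨ξ, hξ⟩ : ∃ ξ : E, orbitD E E' G ((1 : G) : G ⧸ H) ξ =
      smulD E' a⁻¹ (a • ((1 : G) : G ⧸ H)) v := by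
    rw [orbitD_base hM]
    exact hM.submersion 1 _
  rw [mk_eq_smul_one]
  refine ⟨AdL a ξ, (orbitD_smul_AdL a _ ξ).trans ?_⟩
  rw [hξ]
  have h2 := smulD_inv_smulD hM.smooth_smul a⁻¹ (a • ((1 : G) : G ⧸ H)) v
  rwa [inv_inv, inv_smul_smul] at h2

theorem metricAt_orbitD [LieGroup 𝓘(ℝ, E) ∞ G] [IsManifold 𝓘(ℝ, E') ∞ (G ⧸ H)]
    (hM : IsHomogeneousManifold E E' H) {ds : RiemannianMetric E' (G ⧸ H)}
    (hds : IsInvariantMetric ds) (a : G) (X Y : GroupLieAlgebra 𝓘(ℝ, E) G) :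
    metricAt ds (a : G ⧸ H) (orbitD E E' G (a : G ⧸ H) X) (orbitD E E' G (a : G ⧸ H) Y) =
      basePointForm ds (Ad a⁻¹ X) (Ad a⁻¹ Y) := by
  have := hM.smooth_smul
  have hinv : IsInvariantUnder G ds := fun a x v w => hds a x v w
  have key (X Y : E) : metricAt ds (a • ((1 : G) : G ⧸ H))
      (orbitD E E' G (a • ((1 : G) : G ⧸ H)) X) (orbitD E E' G (a • ((1 : G) : G ⧸ H)) Y) =
      metricAt ds ((1 : G) : G ⧸ H) (orbitD E E' G ((1 : G) : G ⧸ H) (AdL a⁻¹ X))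
        (orbitD E E' G ((1 : G) : G ⧸ H) (AdL a⁻¹ Y)) := by
    rw [orbitD_smul, orbitD_smul, hinv]
  rw [mk_eq_smul_one, basePointForm_eq hM]
  exact key X Y

theorem IsExpCurve.hasDerivAt_basePointForm [LieGroup 𝓘(ℝ, E) ∞ G]
    [IsManifold 𝓘(ℝ, E') ∞ (G ⧸ H)]
    (hM : IsHomogeneousManifold E E' H) (ds : RiemannianMetric E' (G ⧸ H)) {γ : ℝ → G}
    {ξ : GroupLieAlgebra 𝓘(ℝ, E) G} (hγ : IsExpCurve γ ξ) (X Y : GroupLieAlgebra 𝓘(ℝ, E) G) :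
    HasDerivAt (fun t => basePointForm ds X (Ad (γ t) Y)) (basePointForm ds X ⁅ξ, Y⁆) 0 := by
  simp only [basePointForm_eq hM]
  let T : E →L[ℝ] ℝ := (metricAt ds ((1 : G) : G ⧸ H)
    (orbitD E E' G ((1 : G) : G ⧸ H) X)).comp (orbitD E E' G ((1 : G) : G ⧸ H))
  exact HasFDerivAt.comp_hasDerivAt (l := T) 0 T.hasFDerivAt (hγ.hasDerivAt_Ad Y)

theorem IsExpCurve.hasDerivAt_basePointForm₂ [LieGroup 𝓘(ℝ, E) ∞ G]
    [IsManifold 𝓘(ℝ, E') ∞ (G ⧸ H)]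
    (hM : IsHomogeneousManifold E E' H) (ds : RiemannianMetric E' (G ⧸ H)) {γ : ℝ → G}
    {ξ : GroupLieAlgebra 𝓘(ℝ, E) G} (hγ : IsExpCurve γ ξ) (X Y : GroupLieAlgebra 𝓘(ℝ, E) G) :
    HasDerivAt (fun t => basePointForm ds (Ad (γ t) X) (Ad (γ t) Y))
      (basePointForm ds ⁅ξ, X⁆ Y + basePointForm ds X ⁅ξ, Y⁆) 0 := by
  simp only [basePointForm_eq hM]
  let D : E →L[ℝ] E' := orbitD E E' G ((1 : G) : G ⧸ H)
  let B : E →L[ℝ] E →L[ℝ] ℝ := (metricAt ds ((1 : G) : G ⧸ H)).bilinearComp D D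
  have h1 : HasDerivAt (fun t => B (Ad (γ t) X)) _ 0 :=
    HasFDerivAt.comp_hasDerivAt (l := B) 0 B.hasFDerivAt (hγ.hasDerivAt_Ad X)
  have h2 := h1.clm_apply (hγ.hasDerivAt_Ad Y)
  rw [hγ.1, Ad_one, Ad_one] at h2
  exact h2

/-- An inner product preserved by a one-parameter group `Ad (exp (t ξ))` makes `ad ξ` skew. -/
theorem IsExpCurve.skew_of_invariant [LieGroup 𝓘(ℝ, E) ∞ G] [IsManifold 𝓘(ℝ, E') ∞ (G ⧸ H)]
    (hM : IsHomogeneousManifold E E' H) (ds : RiemannianMetric E' (G ⧸ H)) {γ : ℝ → G}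
    {ξ : GroupLieAlgebra 𝓘(ℝ, E) G} (hγ : IsExpCurve γ ξ) {X Y : GroupLieAlgebra 𝓘(ℝ, E) G}
    (h : ∀ t, basePointForm ds (Ad (γ t) X) (Ad (γ t) Y) = basePointForm ds X Y) :
    basePointForm ds ⁅ξ, X⁆ Y + basePointForm ds X ⁅ξ, Y⁆ = 0 := by
  have h1 := hγ.hasDerivAt_basePointForm₂ hM ds X Y
  simp only [h] at h1
  exact h1.unique (hasDerivAt_const _ _)

variable [LieGroup 𝓘(ℝ, E) ∞ G] [IsManifold 𝓘(ℝ, E') ∞ (G ⧸ H)]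

/-- The infinitesimal geodesic orbit condition for the symmetric space `K/H`: every `ζ` in `𝔪` is
orthogonal to `⁅ζ, W⁆` for all `W` in the Lie algebra of `K`. -/
theorem IsRiemannianSymmetric.basePointForm_bracket_eq_zero [CompleteSpace E] [T2Space G]
    (hM : IsHomogeneousManifold E E' H) {ds : RiemannianMetric E' (G ⧸ H)}
    {𝔪 : Submodule ℝ (GroupLieAlgebra 𝓘(ℝ, E) G)}
    (hF : IsRiemannianSymmetric K H 𝔪 (basePointForm ds)) {ζ W : GroupLieAlgebra 𝓘(ℝ, E) G}
    (hζ : ζ ∈ 𝔪) (hW : W ∈ lieAlg K) : basePointForm ds ζ ⁅ζ, W⁆ = 0 := by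
  obtain ⟨𝔭, 𝔩, hsup, hperp, hcomm, -, hpp, hlA, hlq⟩ := hF.symmetric
  obtain ⟨Y, hY, Z, hZ, rfl⟩ := hF.reductive.decomp W hW
  have hζ' := hζ
  rw [← hsup, Submodule.mem_sup] at hζ' hZ
  obtain ⟨P₂, hP₂, L₂, hL₂, rfl⟩ := hZ
  obtain ⟨P, hP, L, hL, hPL⟩ := hζ'
  -- The isotropy part: `Ad H` preserves the inner product of `𝔪`.
  have hiso : basePointForm ds ζ ⁅ζ, Y⁆ = 0 := by
    obtain ⟨γ, hγ, hγH⟩ := hY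
    have h := hγ.skew_of_invariant hM ds (X := ζ) (Y := ζ)
      fun t => hF.invariant _ (hγH t) ζ hζ ζ hζ
    rw [basePointForm_symm ds ⁅Y, ζ⁆ ζ] at h
    rw [← neg_bracket, map_neg]
    linarith
  -- The group part: the inner product of `𝔩` is bi-invariant, and `𝔩 ⊥ 𝔭`.
  have hgrp : basePointForm ds ζ ⁅L, L₂⁆ = 0 := by
    have hLm : L ∈ 𝔪 := hsup ▸ Submodule.mem_sup_right hL
    obtain ⟨γ, hγ, hγK⟩ := hF.reductive.subset L hLm
    have h1 := hγ.skew_of_invariant hM ds (X := L) (Y := L₂)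
      fun t => hlq _ (hγK t) L hL L₂ hL₂
    rw [bracket_self, map_zero, LinearMap.zero_apply, zero_add] at h1
    have h2 := hγ.hasDerivAt_basePointForm hM ds P L₂
    simp only [hperp P hP _ (hlA _ (hγK _) L₂ hL₂)] at h2
    have h3 := h2.unique (hasDerivAt_const _ _)
    rw [← hPL, map_add, LinearMap.add_apply, h1, h3, add_zero]
  have hLP : ⁅L, P₂⁆ = 0 := by rw [← neg_bracket, hcomm P₂ hP₂ L hL, neg_zero]
  have hsplit : ⁅ζ, P₂ + L₂⁆ = ⁅P, P₂⁆ + ⁅L, L₂⁆ := by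
    rw [← hPL, bracket_add, add_bracket, add_bracket, hcomm P hP L₂ hL₂, hLP, add_zero, zero_add]
  rw [bracket_add, hsplit, map_add, map_add, hiso, hgrp,
    basePointForm_eq_zero hM ds ζ (hpp P hP P₂ hP₂)]
  simp

end Homogeneous

/-! ### Geodesics tangent to the fiber -/

section Fiber

variable {E E' : Type*} [NormedAddCommGroup E] [NormedSpace ℝ E]
  [NormedAddCommGroup E'] [NormedSpace ℝ E']
  {G : Type*} [TopologicalSpace G] [ChartedSpace E G] [Group G] [LieGroup 𝓘(ℝ, E) ∞ G]
  {H K : Subgroup G} [ChartedSpace E' (G ⧸ H)]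

/-- At `kH`, the tangent space of the fiber is represented by `Ad k` of the complement `𝔪''`. -/
theorem exists_orbitD_eq_Ad (hM : IsHomogeneousManifold E E' H)
    {𝔪'' : Submodule ℝ (GroupLieAlgebra 𝓘(ℝ, E) G)} (hF : IsReductiveComplement K H 𝔪'')
    {k : G} (hk : k ∈ K) {X : GroupLieAlgebra 𝓘(ℝ, E) G} (hX : X ∈ lieAlg K) :
    ∃ ζ ∈ 𝔪'', orbitD E E' G (k : G ⧸ H) X = orbitD E E' G (k : G ⧸ H) (Ad k ζ) := by
  have := hM.smooth_smul
  obtain ⟨Y, hY, ζ, hζ, h⟩ := hF.decomp _ (Ad_mem_lieAlg (K.inv_mem hk) hX)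
  refine ⟨ζ, hζ, ?_⟩
  have h1 : X = Ad k Y + Ad k ζ := by rw [← Ad_add, ← h, Ad_Ad_inv]
  have h2 : orbitD E E' G (k : G ⧸ H) (Ad k Y) = 0 := by
    rw [mk_eq_smul_one]
    refine (orbitD_smul_AdL (E := E) (E' := E') k _ Y).trans ?_
    exact (congrArg _ (orbitD_base_eq_zero hM hY)).trans (map_zero _)
  rw [h1, orbitD_add, h2, zero_add]

variable [IsManifold 𝓘(ℝ, E') ∞ (G ⧸ H)] [T2Space G] [FiniteDimensional ℝ E]

/-- The momenta of an orbit `t ↦ exp (t ζ) H` with `ζ` in `𝔪''` are constant. -/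
theorem IsExpCurve.basePointForm_Ad_eq (hM : IsHomogeneousManifold E E' H)
    {ds : RiemannianMetric E' (G ⧸ H)} {𝔪' 𝔪'' : Submodule ℝ (GroupLieAlgebra 𝓘(ℝ, E) G)}
    (hM' : IsReductiveComplement ⊤ K 𝔪') (hF : IsRiemannianSymmetric K H 𝔪'' (basePointForm ds))
    (horth : ∀ X ∈ 𝔪', ∀ Y ∈ 𝔪'', basePointForm ds X Y = 0)
    {γ : ℝ → G} {ζ : GroupLieAlgebra 𝓘(ℝ, E) G} (hγ : IsExpCurve γ ζ) (hζ : ζ ∈ 𝔪'')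
    (Z : GroupLieAlgebra 𝓘(ℝ, E) G) (t : ℝ) :
    basePointForm ds ζ (Ad (γ t) Z) = basePointForm ds ζ Z := by
  have hγK (t : ℝ) : γ t ∈ K := hγ.mem_of_mem_lieAlg (hF.reductive.subset ζ hζ) t
  obtain ⟨Y, hY, Z', hZ', rfl⟩ := hM'.decomp Z (mem_lieAlg_top Z)
  -- The component in `𝔪'` contributes nothing, and the derivative of that in `𝔨` vanishes.
  have h1 : basePointForm ds ζ (Ad (γ t) Z') = 0 := by
    rw [basePointForm_symm]
    exact horth _ (hM'.invariant _ (hγK t) _ hZ') _ hζ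
  have h2 : basePointForm ds ζ Z' = 0 := by
    rw [basePointForm_symm]
    exact horth _ hZ' _ hζ
  have hd (s : ℝ) : HasDerivAt (fun r => basePointForm ds ζ (Ad (γ r) Y)) 0 s := by
    have h := hγ.hasDerivAt_basePointForm hM ds ζ (Ad (γ s) Y)
    rw [hF.basePointForm_bracket_eq_zero hM hζ (Ad_mem_lieAlg (hγK s) hY)] at h
    have h0 : (fun r => basePointForm ds ζ (Ad (γ r) Y)) =
        fun r => basePointForm ds ζ (Ad (γ (r - s)) (Ad (γ s) Y)) := by
      simp only [← Ad_mul, ← hγ.2.1, sub_add_cancel]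
    rw [h0]
    exact HasDerivAt.comp_sub_const
      (f := fun r => basePointForm ds ζ (Ad (γ r) (Ad (γ s) Y))) s s (by rwa [sub_self])
  have h3 : basePointForm ds ζ (Ad (γ t) Y) = basePointForm ds ζ (Ad (γ 0) Y) :=
    is_const_of_deriv_eq_zero (fun s => (hd s).differentiableAt) (fun s => (hd s).deriv) t 0
  rw [hγ.1, Ad_one] at h3
  rw [Ad_add, map_add, map_add, h1, h2, h3]

variable [FiniteDimensional ℝ E']

/-- A geodesic of `M` that is tangent to the fiber at some point is a `K`-translate of an orbit
`t ↦ exp (t ζ) H` with `ζ` in `𝔪''`. -/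
theorem IsGeodesicOn.exists_eq_mk_mul (hH : IsClosed (H : Set G))
    (hM : IsHomogeneousManifold E E' H)
    {ds : RiemannianMetric E' (G ⧸ H)} (hds : IsInvariantMetric ds) (hHK : H ≤ K)
    {𝔪' 𝔪'' : Submodule ℝ (GroupLieAlgebra 𝓘(ℝ, E) G)}
    (hM' : IsReductiveComplement ⊤ K 𝔪') (hF : IsRiemannianSymmetric K H 𝔪'' (basePointForm ds))
    (horth : ∀ X ∈ 𝔪', ∀ Y ∈ 𝔪'', basePointForm ds X Y = 0)
    {c : ℝ → G ⧸ H} {J : Set ℝ} (hJ : IsOpen J) (hJc : J.OrdConnected)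
    (hc : IsGeodesicOn ds c J) {t₀ : ℝ} (ht₀ : t₀ ∈ J)
    (htan : IsTangentAt (E := E') (fiber hHK) (orbitTangent E H K) c t₀) :
    ∃ k ∈ K, ∃ ζ ∈ 𝔪'', ∃ γ : ℝ → G, IsExpCurve γ ζ ∧ ∀ t ∈ J, c t = ((k * γ t : G) : G ⧸ H) := by
  have := hM.smooth_smul
  have := topologicalGroup_of_lieGroup 𝓘(ℝ, E) ∞ (G := G)
  have := t2Space_quotient hH
  have hinv : IsInvariantUnder G ds := fun a x v w => hds a x v w
  obtain ⟨hcF, X, hX, hcX⟩ := htan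
  have hvel : vel E' c t₀ = orbitD E E' G (c t₀) X := hcX
  obtain ⟨k₀, hk₀, hck⟩ := mem_fiber_iff.1 hcF
  obtain ⟨ζ, hζ, hXζ⟩ := exists_orbitD_eq_Ad (E' := E') hM hF.reductive hk₀ hX
  rw [hck, hXζ] at hvel
  obtain ⟨γ, hγ⟩ := exists_isExpCurve ζ
  have hγK (t : ℝ) : γ t ∈ K := hγ.mem_of_mem_lieAlg (hF.reductive.subset ζ hζ) t
  obtain ⟨k, rfl⟩ : ∃ k, k₀ = k * γ t₀ := ⟨k₀ * (γ t₀)⁻¹, by simp⟩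
  have hk : k ∈ K := (K.mul_mem_cancel_right (hγK t₀)).1 hk₀
  rw [Ad_mul, hγ.Ad_self] at hvel
  refine ⟨k, hk, ζ, hζ, γ, hγ, ?_⟩
  -- The momenta of the orbit `t ↦ k * exp (t ζ) * H`.
  have hmom (t : ℝ) (Z : GroupLieAlgebra 𝓘(ℝ, E) G) : metricAt ds ((k * γ t : G) : G ⧸ H)
      (orbitD E E' G ((k * γ t : G) : G ⧸ H) (Ad k ζ))
      (orbitD E E' G ((k * γ t : G) : G ⧸ H) Z) =
      basePointForm ds ζ (Ad k⁻¹ Z) := by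
    rw [metricAt_orbitD hM hds, mul_inv_rev, Ad_mul, Ad_mul, Ad_inv_Ad, ← hγ.neg_apply, hγ.Ad_self,
      hγ.basePointForm_Ad_eq hM hM' hF horth hζ]
  have hmd {t : ℝ} (ht : t ∈ J) : ContMDiffAt 𝓘(ℝ, ℝ) 𝓘(ℝ, E') 2 c t :=
    hc.1.contMDiffAt (hJ.mem_nhds ht)
  -- The momenta of the geodesic are constant.
  have hcons (Z : E) {t : ℝ} (ht : t ∈ J) :
      HasDerivAt (fun s => metricAt ds (c s) (vel E' c s) (orbitD E E' G (c s) Z)) 0 t := by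
    refine (hasDerivAt_momentum hinv (hmd ht) (mem_extChartAt_source (c t)) Z).congr_deriv ?_
    exact hc.2 t ht (c t) (mem_extChartAt_source (c t)) _
  refine eqOn_of_momentum_eq (E := E) (G := G) (g := ds) (c₂ := fun t => ((k * γ t : G) : G ⧸ H))
    (v₁ := vel E' c)
    (v₂ := fun t => orbitD E E' G ((k * γ t : G) : G ⧸ H) (Ad k ζ))
    (p := fun Z => basePointForm ds ζ (Ad k⁻¹ (Z : GroupLieAlgebra 𝓘(ℝ, E) G)))
    (orbitD_surjective hM) hJ hJc
    (fun t ht => hasMFDerivAt_vel ((hmd ht).mdifferentiableAt (by simp)))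
    (fun t _ => ?_) (fun t ht Z => ?_) (fun t _ Z => hmom t Z) ht₀ hck
  · have h := (hγ.conj k).hasMFDerivAt_smul (E' := E') (k : G ⧸ H) t
    have h1 : (fun s => (k * γ s * k⁻¹) • (k : G ⧸ H)) = fun s => ((k * γ s : G) : G ⧸ H) :=
      funext fun s => (mk_mul_eq_conj_smul k (γ s)).symm
    rw [h1, ← mk_mul_eq_conj_smul] at h
    exact h
  · have h1 := hJ.is_const_of_deriv_eq_zero hJc.isPreconnected
      (fun s hs => (hcons Z hs).differentiableAt.differentiableWithinAt)
      (fun s hs => (hcons Z hs).deriv) ht ht₀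
    rw [h1, hvel, hck]
    exact hmom t₀ Z

/-- The second fundamental form of the fiber vanishes: the fundamental fields of `𝔪'` are normal
along the fiber, so that a geodesic of the fiber has zero momentum for them. -/
theorem IsSubmanifoldGeodesicOn.isGeodesicOn (hM : IsHomogeneousManifold E E' H)
    {ds : RiemannianMetric E' (G ⧸ H)} (hds : IsInvariantMetric ds) (hHK : H ≤ K)
    {𝔪' 𝔪'' : Submodule ℝ (GroupLieAlgebra 𝓘(ℝ, E) G)}
    (hM' : IsReductiveComplement ⊤ K 𝔪') (hF : IsReductiveComplement K H 𝔪'')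
    (horth : ∀ X ∈ 𝔪', ∀ Y ∈ 𝔪'', basePointForm ds X Y = 0)
    {c : ℝ → G ⧸ H} {J : Set ℝ} (hJ : IsOpen J)
    (hc : IsSubmanifoldGeodesicOn ds (fiber hHK) (orbitTangent E H K) c J) :
    IsGeodesicOn ds c J := by
  have := hM.smooth_smul
  have : IsManifold 𝓘(ℝ, E') 1 (G ⧸ H) := isManifold_one
  have hinv : IsInvariantUnder G ds := fun a x v w => hds a x v w
  refine ⟨hc.1, fun t ht a ha w => ?_⟩
  obtain ⟨v, rfl⟩ : ∃ v, chartD a (c t) v = w := by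
    have h := chartD_comp_chartDSymm ((extChartAt 𝓘(ℝ, E') a).map_source ha)
    rw [(extChartAt 𝓘(ℝ, E') a).left_inv ha] at h
    exact ⟨_, congrArg (fun T : E' →L[ℝ] E' => T w) h⟩
  obtain ⟨Z, rfl⟩ := orbitD_surjective (E := E) hM (c t) v
  obtain ⟨Y, hY, Z', hZ', hZ⟩ := hM'.decomp (Z : GroupLieAlgebra 𝓘(ℝ, E) G) (mem_lieAlg_top _)
  -- The fundamental fields of `𝔪'` are orthogonal to the fiber.
  have hperp {s : ℝ} (hs : s ∈ J) :
      metricAt ds (c s) (vel E' c s) (orbitD E E' G (c s) (Z' : E)) = 0 := by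
    obtain ⟨hcF, X, hX, hcX⟩ := hc.2.1 s hs
    have hvel : vel E' c s = orbitD E E' G (c s) X := hcX
    obtain ⟨k, hk, hck⟩ := mem_fiber_iff.1 hcF
    obtain ⟨ζ, hζ, hXζ⟩ := exists_orbitD_eq_Ad (E' := E') hM hF hk hX
    rw [hvel, hck, hXζ]
    refine (metricAt_orbitD hM hds k (Ad k ζ) Z').trans ?_
    rw [Ad_inv_Ad, basePointForm_symm]
    exact horth _ (hM'.invariant _ (K.inv_mem hk) _ hZ') _ hζ
  have hmd : ContMDiffAt 𝓘(ℝ, ℝ) 𝓘(ℝ, E') 2 c t := hc.1.contMDiffAt (hJ.mem_nhds ht)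
  have h1 := hasDerivAt_momentum (E := E) hinv hmd ha Z
  have h2 := hasDerivAt_momentum (E := E) hinv hmd ha Y
  have h3 : (fun s => metricAt ds (c s) (vel E' c s) (orbitD E E' G (c s) Z)) =ᶠ[𝓝 t]
      fun s => metricAt ds (c s) (vel E' c s) (orbitD E E' G (c s) (Y : E)) := by
    filter_upwards [hJ.mem_nhds ht] with s hs
    have h4 : orbitD E E' G (c s) Z =
        orbitD E E' G (c s) (Y : E) + orbitD E E' G (c s) (Z' : E) :=
      (congrArg _ hZ).trans (orbitD_add (c s) Y Z')
    rw [h4, map_add, hperp hs, add_zero]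
  rw [h1.unique (h2.congr_of_eventuallyEq h3)]
  exact hc.2.2 t ht a ha _ ⟨Y, hY, rfl⟩

end Fiber

end GeodesicOrbit

end

theorem mainTheorem6
    {E E' : Type*} [NormedAddCommGroup E] [NormedSpace ℝ E] [FiniteDimensional ℝ E]
    [NormedAddCommGroup E'] [NormedSpace ℝ E'] [FiniteDimensional ℝ E']
    -- the compact connected simply connected Lie group
    {G : Type*} [TopologicalSpace G] [ChartedSpace E G] [Group G] [LieGroup 𝓘(ℝ, E) ∞ G]
    [T2Space G] [CompactSpace G] [ConnectedSpace G] [SimplyConnectedSpace G]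
    -- the closed connected subgroups
    (H K : Subgroup G) (hHK : H ≤ K)
    (hH : IsClosed (H : Set G)) (hHc : IsConnected (H : Set G))
    (hK : IsClosed (K : Set G)) (hKc : IsConnected (K : Set G))
    -- `M = G/H` with a `G`-invariant Riemannian metric
    [ChartedSpace E' (G ⧸ H)] [IsManifold 𝓘(ℝ, E') ∞ (G ⧸ H)]
    (hM : IsHomogeneousManifold E E' H)
    (ds : RiemannianMetric E' (G ⧸ H)) (hds : IsInvariantMetric ds)
    -- `M' = G/K` with a `G`-invariant metric, and `F = H\K` with the metric induced from `M`,
    -- are Riemannian symmetric spaces with tangent spaces `𝔪'` and `𝔪''`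
    (𝔪' 𝔪'' : Submodule ℝ (GroupLieAlgebra 𝓘(ℝ, E) G))
    (ds' : LinearMap.BilinForm ℝ (GroupLieAlgebra 𝓘(ℝ, E) G))
    (hM' : IsRiemannianSymmetric ⊤ K 𝔪' ds')
    (hF : IsRiemannianSymmetric K H 𝔪'' (basePointForm ds))
    -- `𝔪' ⊥ 𝔪''` in the tangent space of `M`
    (horth : ∀ X ∈ 𝔪', ∀ Y ∈ 𝔪'', basePointForm ds X Y = 0) :
    -- the fiber is totally geodesic
    IsTotallyGeodesic ds (fiber hHK) (orbitTangent E H K) ∧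
    -- the fiber is a geodesic orbit space
    (∀ (J : Set ℝ) (c : ℝ → G ⧸ H), IsOpen J → J.OrdConnected →
      IsSubmanifoldGeodesicOn ds (fiber hHK) (orbitTangent E H K) c J →
      ∃ x ∈ fiber hHK, ∃ ξ ∈ lieAlg (E := E) K, ∃ γ : ℝ → G,
        IsExpCurve γ ξ ∧ ∀ t ∈ J, c t = γ t • x) ∧
    -- geodesics of `M` tangent to the fiber
    (∀ (J : Set ℝ) (c : ℝ → G ⧸ H), IsOpen J → J.OrdConnected →
      IsGeodesicOn ds c J →
      (∃ t ∈ J, IsTangentAt (E := E') (fiber hHK) (orbitTangent E H K) c t) →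
      ∃ x ∈ fiber hHK, ∃ ξ ∈ complementAt H K 𝔪'' x, ∃ γ : ℝ → G,
        IsExpCurve γ ξ ∧ ∀ t ∈ J, c t = γ t • x) := by
  have := topologicalGroup_of_lieGroup 𝓘(ℝ, E) ∞ (G := G)
  have hgeo (J : Set ℝ) (c : ℝ → G ⧸ H) (hJ : IsOpen J) (hJc : J.OrdConnected)
      (hc : IsGeodesicOn ds c J)
      (htan : ∃ t ∈ J, IsTangentAt (E := E') (fiber hHK) (orbitTangent E H K) c t) :
      ∃ k ∈ K, ∃ ζ ∈ 𝔪'', ∃ γ : ℝ → G,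
        IsExpCurve γ ζ ∧ ∀ t ∈ J, c t = ((k * γ t : G) : G ⧸ H) := by
    obtain ⟨t₀, ht₀, h⟩ := htan
    exact hc.exists_eq_mk_mul hH hM hds hHK hM'.reductive hF horth hJ hJc ht₀ h
  have hsub (J : Set ℝ) (c : ℝ → G ⧸ H) (hJ : IsOpen J)
      (hc : IsSubmanifoldGeodesicOn ds (fiber hHK) (orbitTangent E H K) c J) :
      IsGeodesicOn ds c J :=
    hc.isGeodesicOn hM hds hHK hM'.reductive hF.reductive horth hJ
  refine ⟨⟨fun J c hJ _ hc => hsub J c hJ hc, fun J c hJ hJc hc htan t ht => ?_⟩,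
    fun J c hJ hJc hc => ?_, fun J c hJ hJc hc htan => ?_⟩
  · obtain ⟨k, hk, ζ, hζ, γ, hγ, h⟩ := hgeo J c hJ hJc hc htan
    exact mem_fiber_iff.2 ⟨_, K.mul_mem hk
      (hγ.mem_of_mem_lieAlg (hF.reductive.subset ζ hζ) t), h t ht⟩
  · rcases J.eq_empty_or_nonempty with rfl | ⟨t₀, ht₀⟩
    · -- On the empty interval any orbit will do.
      obtain ⟨γ, hγ, -⟩ := hF.reductive.subset 0 𝔪''.zero_mem
      exact ⟨_, mem_fiber_iff.2 ⟨1, K.one_mem, rfl⟩, 0,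
        hF.reductive.subset 0 𝔪''.zero_mem, γ, hγ, by simp⟩
    · obtain ⟨k, hk, ζ, hζ, γ, hγ, h⟩ := hgeo J c hJ hJc (hsub J c hJ hc) ⟨t₀, ht₀, hc.2.1 t₀ ht₀⟩
      exact ⟨_, mem_fiber_iff.2 ⟨k, hk, rfl⟩, Ad k ζ,
        Ad_mem_lieAlg hk (hF.reductive.subset ζ hζ), _, hγ.conj k,
        fun t ht => (h t ht).trans (mk_mul_eq_conj_smul k (γ t))⟩
  · obtain ⟨k, hk, ζ, hζ, γ, hγ, h⟩ := hgeo J c hJ hJc hc htan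
    exact ⟨_, mem_fiber_iff.2 ⟨k, hk, rfl⟩, Ad k ζ, ⟨k, hk, rfl, ζ, hζ, rfl⟩, _, hγ.conj k,
      fun t ht => (h t ht).trans (mk_mul_eq_conj_smul k (γ t))⟩
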